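/- Let $n\ge 1$ and let $\Omega\subset\mathbb R^n$ be a bounded domain (a nonempty, bounded, connected open set). If $n>1$, suppose that there exist $n$ points $x_1,\dots,x_n\in\partial\Omega$, in a neighbourhood of each of which $\partial\Omega$ is $C^1$ (that is, in a ball around $x_i$ and in suitable orthonormal coordinates, $\Omega$ is the region strictly below the graph of a $C^1$ function and $\partial\Omega$ is that graph), such that the corresponding unit outward normals $\nu_1,\dots,\nu_n$ span $\mathbb R^n$. Let $M^{n\times n}_+$ be the set of real $n\times n$ matrices with positive determinant, let $\Psi:M^{n\times n}_+\to\mathbb R$ be continuous, and for $M\in M^{n\times n}_+$ let $\mathcal A_M$ be the set of orientation-preserving diffeomorphisms $y$ of $\Omega$ onto $M\Omega=\{Mx:x\in\Omega\}$, that is, of $C^1$ bijections $y:\Omega\to M\Omega$ with $C^1$ inverse and $\det Dy>0$ in $\Omega$. Then $$\frac{1}{\mathcal L^n(\Omega)}\int_\Omega \Psi(Dy(x))\,dx\ \ge\ \Psi(M)\qquad\text{for all } M\in M^{n\times n}_+ \text{ and all } y\in\mathcal A_M$$ if and only if there is a convex function $h:(0,\infty)\to\mathbb R$ such that $$\Psi(A)=h(\det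 A)\qquad\text{for all } A\in M^{n\times n}_+.$$ Here $\mathcal L^n$ is Lebesgue measure, and the inequality means that the integral is well defined in $(-\infty,+\infty]$ (the negative part of $\Psi(Dy)$ is integrable) and that the inequality holds, the value $+\infty$ being allowed. -/

import Mathlib

open MeasureTheory Set
open scoped InnerProductSpace

noncomputable section

namespace BoundarySliding

/-- Euclidean space `ℝⁿ`. -/
abbrev E (n : ℕ) : Type := EuclideanSpace ℝ (Fin n)

/-- The set `M₊^{n×n}` of real `n × n` matrices with positive determinant. -/
def MatPos (n : ℕ) : Set (Matrix (Fin n) (Fin n) ℝ) := {A | 0 < A.det}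

/-- The image `M Ω = {M x : x ∈ Ω}` of a set under a matrix. -/
def matImage {n : ℕ} (M : Matrix (Fin n) (Fin n) ℝ) (Ω : Set (E n)) : Set (E n) :=
  (fun x : E n => WithLp.toLp 2 (M.mulVec (WithLp.ofLp x))) '' Ω

/-- The gradient (Jacobian matrix) `Dy(x)`, with entries `∂yᵢ/∂xⱼ (x)`. -/
def grad {n : ℕ} (y : E n → E n) (x : E n) : Matrix (Fin n) (Fin n) ℝ :=
  Matrix.of fun i j => (fderiv ℝ y x (EuclideanSpace.single j 1)) i

/-- `y` restricts to a `C¹` diffeomorphism of the (open) set `U` onto the (open) set `V`, with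
positive Jacobian determinant. The values of `y` outside `U` play no role. -/
structure IsOrientationPreservingDiffeo {n : ℕ} (U V : Set (E n)) (y : E n → E n) : Prop where
  contDiffOn : ContDiffOn ℝ 1 y U
  mapsTo : MapsTo y U V
  exists_inverse : ∃ g : E n → E n, ContDiffOn ℝ 1 g V ∧ MapsTo g V U ∧ InvOn g y U V
  det_pos : ∀ x ∈ U, 0 < (grad y x).det

/-- The class `𝒜_M` of orientation-preserving diffeomorphisms of `Ω` onto `M Ω`. -/
def admissible {n : ℕ} (Ω : Set (E n)) (M : Matrix (Fin n) (Fin n) ℝ) : Set (E n → E n) :=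
  {y | IsOrientationPreservingDiffeo Ω (matImage M Ω) y}

/-- In a ball around `x`, in an orthonormal coordinate system with vertical unit vector `e`, the
set `Ω` is the region strictly below the graph of the `C¹` function `f` of the horizontal
coordinates `z' ∈ e^⊥`, and its boundary is that graph. -/
structure IsC1SubgraphNear {n : ℕ} (Ω : Set (E n)) (x e : E n)
    (f : (Submodule.span ℝ {e})ᗮ → ℝ) : Prop where
  norm_eq_one : ‖e‖ = 1
  contDiff : ContDiff ℝ 1 f
  exists_ball : ∃ ε > 0,
    Ω ∩ Metric.ball x ε =
      {z ∈ Metric.ball x ε | ⟪e, z⟫_ℝ < f ((Submodule.span ℝ {e})ᗮ.orthogonalProjectionOnto z)} ∧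
    frontier Ω ∩ Metric.ball x ε =
      {z ∈ Metric.ball x ε | ⟪e, z⟫_ℝ = f ((Submodule.span ℝ {e})ᗮ.orthogonalProjectionOnto z)}

/-- `x` is a boundary point of `Ω`, the boundary is `C¹` in a neighbourhood of `x`, and `ν` is the
unit outward normal at `x`: if the boundary is the graph of `f` over `e^⊥` near `x = (x', f x')`,
with `Ω` below it, then `ν = (e - ∇f(x')) / |e - ∇f(x')|`. -/
def IsC1OutwardNormal {n : ℕ} (Ω : Set (E n)) (x ν : E n) : Prop :=
  x ∈ frontier Ω ∧
    ∃ (e : E n) (f : (Submodule.span ℝ {e})ᗮ → ℝ), IsC1SubgraphNear Ω x e f ∧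
      ∃ w : E n,
        w = e - ((gradient f ((Submodule.span ℝ {e})ᗮ.orthogonalProjectionOnto x) :
          (Submodule.span ℝ {e})ᗮ) : E n) ∧
        ν = ‖w‖⁻¹ • w

/-- The average `⨍_Ω f` of a real function as an extended real number: the average of the positive
part minus the average of the negative part. It is `+∞` if only the positive part has an infinite
integral, and `-∞` if the negative part has an infinite integral (in `EReal`, `⊤ - ⊤ = ⊥`), so that
`c ≤ extAverage Ω f` for a real `c` says that the negative part is integrable, hence that
the average is well defined in `(-∞, +∞]`, and that it is at least `c`. -/
def extAverage {n : ℕ} (Ω : Set (E n)) (f : E n → ℝ) : EReal :=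
  ((⨍⁻ x in Ω, ENNReal.ofReal (f x) ∂volume : ENNReal) : EReal) -
    ((⨍⁻ x in Ω, ENNReal.ofReal (-f x) ∂volume : ENNReal) : EReal)

end BoundarySliding

end

/-! If `Ψ = h ∘ det`, bound `h` below by a supporting line at `det M`. By change of variables `det
Dy` integrates to the volume of `M Ω`, so the average of that line is exactly `h (det M)`, and the
same affine bound controls the negative part (`le_extAverage_of_convexOn`).

Conversely, only competitors `A ∘ φ` are needed, with `φ` a diffeomorphism of the whole space
preserving `Ω` (`IsStable`). Near a `C¹` boundary point, flatten the boundary and slide along it.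
With lengths scaled by `r` tangentially and `r ^ 2` normally, the map `z + r * bump z • τ` moves
points by order `r ^ 2` across a layer of thickness `r ^ 2`. As `r → 0` its gradient tends to the
identity plus `p = ∂ₑ bump` times a fixed shear `σ ⊗ m`, with `m` the normal covector and `m σ = 0`.
Such shears compose additively, so `g t = Φ (B (1 + t σ ⊗ m))` satisfies `0 ≤ ∫ (g (a + l p) - g a)`
for all real `a`, `l`. The integral is over a half-ball on which `p ≥ 0`: unlike for an interior
perturbation, `p` does not average to zero, and `g` must be constant
(`eq_of_forall_setIntegral_nonneg`). Hence `Φ` is invariant under these shears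
(`IsStable.apply_mul_shear`).

In the basis dual to `n` spanning normals the shears include all elementary transvections. These
generate `SL(n)`, so `Ψ` depends only on the determinant (`eq_of_det_eq_of_shear_invariant`); for `n
= 1` this is automatic. Interior perturbations, whose Jacobian averages to one, then give convexity
(`IsStable.convexOn`). -/

noncomputable section

namespace BoundarySliding

open Filter Topology

/-! ### Perturbations of the identity and determinants. -/

/-- A `C¹` perturbation of the identity with small derivative is a global `C¹` diffeomorphism. -/
theorem exists_homeomorph_id_add {V : Type*} [NormedAddCommGroup V] [NormedSpace ℝ V]
    [CompleteSpace V] {u : V → V} (hu : ContDiff ℝ 1 u) (hb : ∀ x, ‖fderiv ℝ u x‖ ≤ 1 / 2) :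
    ∃ φ : V ≃ₜ V, (∀ x, φ x = x + u x) ∧ ContDiff ℝ 1 φ ∧ ContDiff ℝ 1 φ.symm := by
  -- The identity has norm one, as used for `hlt`, only on a nontrivial space.
  rcases subsingleton_or_nontrivial V with hV | hV
  · refine ⟨Homeomorph.refl V, fun x => Subsingleton.elim _ _, contDiff_id, contDiff_id⟩
  have hlip : LipschitzWith (1 / 2 : NNReal) u := by
    refine lipschitzWith_of_nnnorm_fderiv_le (hu.differentiable one_ne_zero) fun x => ?_
    have := hb x
    rw [← NNReal.coe_le_coe]
    simpa using this
  have happ : ApproximatesLinearOn (fun x => x + u x)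
      ((ContinuousLinearEquiv.refl ℝ V : V ≃L[ℝ] V) : V →L[ℝ] V) univ (1 / 2 : NNReal) := by
    intro x _ y _
    have := hlip.norm_sub_le x y
    simpa [add_sub_add_comm] using this
  have hlt : (1 / 2 : NNReal) <
      ‖((ContinuousLinearEquiv.refl ℝ V : V ≃L[ℝ] V).symm : V →L[ℝ] V)‖₊⁻¹ := by
    have : ‖((ContinuousLinearEquiv.refl ℝ V : V ≃L[ℝ] V).symm : V →L[ℝ] V)‖₊ = 1 := by
      ext
      simp
    rw [this, inv_one]
    exact NNReal.half_lt_self one_ne_zero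
  let φ := happ.toHomeomorph _ (Or.inr hlt)
  have hφ : ∀ x, φ x = x + u x := fun x => rfl
  have hφ' : (φ : V → V) = fun x => x + u x := funext hφ
  have hc : ContDiff ℝ 1 φ := by rw [hφ']; exact contDiff_id.add hu
  refine ⟨φ, hφ, hc, ?_⟩
  have hn : ∀ x, ‖-fderiv ℝ u x‖ < 1 := fun x => by
    rw [norm_neg]; exact (hb x).trans_lt (by norm_num)
  refine φ.contDiff_symm
    (f₀' := fun x => ContinuousLinearEquiv.ofUnit (Units.oneSub (-fderiv ℝ u x) (hn x)))
    (fun x => ?_) hc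
  rw [hφ']
  have := (hasFDerivAt_id x).add (hu.differentiable one_ne_zero x).hasFDerivAt
  refine this.congr_fderiv ?_
  ext v
  simp [ContinuousLinearEquiv.ofUnit]

theorem det_one_add_smulRight {V : Type*} [NormedAddCommGroup V] [NormedSpace ℝ V]
    [FiniteDimensional ℝ V] (m : V →L[ℝ] ℝ) (v : V) :
    (1 + m.smulRight v : V →L[ℝ] V).det = 1 + m v := by
  have := LinearMap.transvection.det (m : V →ₗ[ℝ] ℝ) v
  rw [← ContinuousLinearMap.coe_coe m, ← this]
  rfl

/-- The unit vector rules out dimension zero, where every determinant is one. -/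
theorem exists_det_eq {V : Type*} [NormedAddCommGroup V]
    [InnerProductSpace ℝ V] [FiniteDimensional ℝ V] (e : V) (he : ‖e‖ = 1) (t : ℝ) :
    ∃ A : V →L[ℝ] V, A.det = t := by
  refine ⟨1 + (innerSL ℝ e).smulRight ((t - 1) • e), ?_⟩
  rw [det_one_add_smulRight]
  simp [he]

theorem clm_det_mul {V : Type*} [NormedAddCommGroup V] [NormedSpace ℝ V]
    (A B : V →L[ℝ] V) : (A * B).det = A.det * B.det :=
  LinearMap.det_comp (A : V →ₗ[ℝ] V) (B : V →ₗ[ℝ] V)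

theorem continuous_det {V : Type*} [NormedAddCommGroup V] [NormedSpace ℝ V] :
    Continuous fun A : V →L[ℝ] V => A.det := ContinuousLinearMap.continuous_det

/-! ### An explicit radial bump function. -/

section Bump

section

variable {V : Type*} [NormedAddCommGroup V]

/-- A nonnegative, compactly supported, radial `C¹` function. -/
def bump (z : V) : ℝ := (max 0 (1 - ‖z‖ ^ 2)) ^ 2

/-- Squaring removes the kink of `max 0` at the origin, which is what makes `bump` of class `C¹`. -/
theorem hasDerivAt_max_zero_sq (t : ℝ) :
    HasDerivAt (fun s : ℝ => (max 0 s) ^ 2) (2 * max 0 t) t := by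
  rcases lt_trichotomy t 0 with h | rfl | h
  · have : (fun s : ℝ => (max 0 s) ^ 2) =ᶠ[𝓝 t] fun _ => 0 := by
      filter_upwards [eventually_lt_nhds h] with s hs
      simp [max_eq_left hs.le]
    rw [max_eq_left h.le, mul_zero]
    exact (hasDerivAt_const t (0 : ℝ)).congr_of_eventuallyEq this
  · rw [hasDerivAt_iff_isLittleO_nhds_zero]
    simp only [zero_add, max_self, mul_zero, smul_zero, sub_zero, ne_eq, OfNat.ofNat_ne_zero,
      not_false_eq_true, zero_pow]
    have h1 : (fun h : ℝ => (max 0 h) ^ 2) =O[𝓝 0] fun h : ℝ => h ^ 2 := by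
      refine Asymptotics.IsBigO.of_bound 1 (Eventually.of_forall fun h => ?_)
      rw [one_mul, norm_pow, norm_pow]
      gcongr
      rcases le_total 0 h with hh | hh <;> simp [hh]
    exact h1.trans_isLittleO (Asymptotics.isLittleO_pow_id one_lt_two)
  · have : (fun s : ℝ => (max 0 s) ^ 2) =ᶠ[𝓝 t] fun s => s ^ 2 := by
      filter_upwards [eventually_gt_nhds h] with s hs
      simp [max_eq_right hs.le]
    rw [max_eq_right h.le]
    simpa using (hasDerivAt_pow 2 t).congr_of_eventuallyEq this

theorem continuous_bump : Continuous (bump : V → ℝ) := by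
  unfold bump
  fun_prop

theorem bump_of_one_le_norm {z : V} (hz : 1 ≤ ‖z‖) : bump z = 0 := by
  have : 1 - ‖z‖ ^ 2 ≤ 0 := by nlinarith
  simp [bump, max_eq_left this]

theorem bump_nonneg (z : V) : 0 ≤ bump z := by unfold bump; positivity

theorem bump_le_one (z : V) : bump z ≤ 1 := by
  unfold bump
  have h0 : 0 ≤ max 0 (1 - ‖z‖ ^ 2) := le_max_left _ _
  have h1 : max 0 (1 - ‖z‖ ^ 2) ≤ 1 := max_le zero_le_one (by nlinarith [sq_nonneg ‖z‖])
  nlinarith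

end

variable {V : Type*} [NormedAddCommGroup V] [InnerProductSpace ℝ V]

/-- The derivative of `bump`. -/
def bumpDeriv (z : V) : V →L[ℝ] ℝ := (-4 * max 0 (1 - ‖z‖ ^ 2)) • innerSL ℝ z

theorem hasFDerivAt_bump (z : V) : HasFDerivAt bump (bumpDeriv z) z := by
  have h1 : HasFDerivAt (fun z : V => 1 - ‖z‖ ^ 2) (-(2 • innerSL ℝ z)) z := by
    simpa using ((hasStrictFDerivAt_norm_sq z).hasFDerivAt).const_sub 1
  have := (hasDerivAt_max_zero_sq (1 - ‖z‖ ^ 2)).comp_hasFDerivAt z h1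
  refine this.congr_fderiv ?_
  ext v
  simp [bumpDeriv]
  ring

theorem continuous_bumpDeriv : Continuous (bumpDeriv : V → V →L[ℝ] ℝ) := by
  unfold bumpDeriv
  fun_prop

theorem contDiff_bump : ContDiff ℝ 1 (bump : V → ℝ) :=
  contDiff_one_iff_hasFDerivAt.2 ⟨bumpDeriv, continuous_bumpDeriv, hasFDerivAt_bump⟩

theorem bumpDeriv_apply (z v : V) :
    bumpDeriv z v = -4 * max 0 (1 - ‖z‖ ^ 2) * ⟪z, v⟫_ℝ := by simp [bumpDeriv]

theorem bumpDeriv_of_one_le_norm {z : V} (hz : 1 ≤ ‖z‖) : bumpDeriv z = 0 := by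
  have : 1 - ‖z‖ ^ 2 ≤ 0 := by nlinarith
  simp [bumpDeriv, max_eq_left this]

theorem norm_bumpDeriv_le (z : V) : ‖bumpDeriv z‖ ≤ 4 := by
  rcases le_total 1 ‖z‖ with h | h
  · simp [bumpDeriv_of_one_le_norm h]
  · have h1 : max 0 (1 - ‖z‖ ^ 2) ≤ 1 := max_le zero_le_one (by nlinarith [sq_nonneg ‖z‖])
    have h0 : 0 ≤ max 0 (1 - ‖z‖ ^ 2) := le_max_left _ _
    rw [bumpDeriv, norm_smul, norm_mul, innerSL_apply_norm, Real.norm_eq_abs, Real.norm_eq_abs,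
      abs_of_nonneg h0]
    norm_num
    nlinarith [norm_nonneg z]

theorem abs_bumpDeriv_apply_le (z v : V) : |bumpDeriv z v| ≤ 4 * ‖v‖ :=
  ((bumpDeriv z).le_opNorm v).trans (by gcongr; exact norm_bumpDeriv_le z)

end Bump

/-! ### Rigidity from integral inequalities. -/

theorem eq_zero_of_setIntegral_nonneg {V : Type*} [TopologicalSpace V] [MeasurableSpace V]
    [OpensMeasurableSpace V] {μ : Measure V} [μ.IsOpenPosMeasure] {U : Set V} (hU : IsOpen U)
    {q : V → ℝ} (hq : ContinuousOn q U) (hi : IntegrableOn q U μ) (hle : ∀ x ∈ U, q x ≤ 0)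
    (h : 0 ≤ ∫ x in U, q x ∂μ) : ∀ x ∈ U, q x = 0 := by
  have h0 : 0 ≤ᵐ[μ.restrict U] fun x => -q x := by
    filter_upwards [ae_restrict_mem hU.measurableSet] with x hx
    simpa using hle x hx
  have h1 : ∫ x in U, -q x ∂μ = 0 := by
    refine le_antisymm ?_ (integral_nonneg_of_ae h0)
    rw [integral_neg]; linarith
  have h2 := (integral_eq_zero_iff_of_nonneg_ae h0 hi.neg).1 h1
  have h3 : q =ᵐ[μ.restrict U] fun _ => 0 := by
    filter_upwards [h2] with x hx
    simpa using hx
  exact fun x hx => Measure.eqOn_open_of_ae_eq h3 hU hq continuousOn_const hx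

/-- If the integrals over `U` of all the functions `g (a + l p)` are at least those of the
constants `g a`, where `p` is nonnegative and does not vanish, then `g` is constant. -/
theorem eq_of_forall_setIntegral_nonneg {V : Type*} [TopologicalSpace V] [MeasurableSpace V]
    [OpensMeasurableSpace V] {μ : Measure V} [μ.IsOpenPosMeasure] {U : Set V} (hU : IsOpen U)
    (hμ : μ U ≠ ⊤) {p : V → ℝ} (hp : Continuous p) {P : ℝ} (hpP : ∀ x, p x ≤ P)
    (hp0 : ∀ x ∈ U, 0 ≤ p x) {z : V} (hz : z ∈ U) (hpz : 0 < p z) {g : ℝ → ℝ} (hg : Continuous g)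
    (h : ∀ a l : ℝ, 0 ≤ ∫ x in U, (g (a + l * p x) - g a) ∂μ) (a b : ℝ) : g a = g b := by
  have hP : 0 < P := hpz.trans_le (hpP z)
  -- Monotonicity suffices: the hypothesis is stable under `s ↦ -s`, since `l` has either sign, and
  -- this gives the reverse inequality.
  have key : ∀ {g : ℝ → ℝ}, Continuous g →
      (∀ a l : ℝ, 0 ≤ ∫ x in U, (g (a + l * p x) - g a) ∂μ) → ∀ a b, a < b → g a ≤ g b := by
    intro g hg h a b hab
    by_contra! hlt
    -- Take the last point `t` of `[a, b]` with `g a ≤ g t`. Beyond it `g` is strictly below `g t`,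
    -- so pushing `t` to the right by `l * p` can only lower the integral.
    obtain ⟨t, ⟨htab, hta⟩, htmax⟩ :=
      (isCompact_Icc.inter_right (isClosed_Ici.preimage hg : IsClosed (g ⁻¹' Ici (g a)))
        : IsCompact (Icc a b ∩ g ⁻¹' Ici (g a))).exists_isGreatest
        ⟨a, ⟨le_rfl, hab.le⟩, le_refl (g a)⟩
    have hta' : g a ≤ g t := hta
    have htb : t < b := lt_of_le_of_ne htab.2 (by rintro rfl; linarith)
    have hlt' : ∀ s, t < s → s ≤ b → g s < g t := by
      intro s hs hsb
      by_contra! hcon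
      have : s ≤ t := htmax ⟨⟨htab.1.trans hs.le, hsb⟩, hta'.trans hcon⟩
      linarith
    -- This size keeps `t + l * p` inside `[t, b]`.
    set l := (b - t) / P with hl
    have hl0 : 0 < l := div_pos (by linarith) hP
    have hlp : ∀ x, t + l * p x ≤ b := by
      intro x
      have : l * p x ≤ l * P := by gcongr; exact hpP x
      have h2 : l * P = b - t := by rw [hl]; field_simp
      linarith
    have hcont : Continuous fun x => g (t + l * p x) - g t := by fun_prop
    have hle : ∀ x ∈ U, g (t + l * p x) - g t ≤ 0 := by
      intro x hx
      rcases (hp0 x hx).eq_or_lt with h0 | h0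
      · simp [← h0]
      · have := hlt' (t + l * p x) (by nlinarith) (hlp x)
        linarith
    have hint : IntegrableOn (fun x => g (t + l * p x) - g t) U μ := by
      obtain ⟨C, hC⟩ := (isCompact_Icc (a := t) (b := b)).exists_bound_of_continuousOn
        (f := fun s => g s - g t) (by fun_prop)
      refine IntegrableOn.of_bound (lt_top_iff_ne_top.2 hμ)
        hcont.measurable.aestronglyMeasurable C ?_
      filter_upwards [ae_restrict_mem hU.measurableSet] with x hx
      exact hC _ ⟨by nlinarith [hp0 x hx], hlp x⟩
    have := eq_zero_of_setIntegral_nonneg hU hcont.continuousOn hint hle (h t l) z hz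
    have := hlt' (t + l * p z) (by nlinarith) (hlp z)
    linarith
  have key' := key (g := fun s => g (-s)) (by fun_prop) fun a l => by
    have := h (-a) (-l)
    convert this using 5
    ring
  have : ∀ a b, a < b → g a = g b := fun a b hab =>
    le_antisymm (key hg h a b hab) (by simpa using key' (-b) (-a) (by linarith))
  rcases lt_trichotomy a b with hab | rfl | hab
  · exact this a b hab
  · rfl
  · exact (this b a hab).symm

end BoundarySliding

end

/-! ### Stability under diffeomorphisms preserving the domain, and convexity. -/

noncomputable section

namespace BoundarySliding

open Filter Topology

variable {V : Type*} [NormedAddCommGroup V] [InnerProductSpace ℝ V] [FiniteDimensional ℝ V]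
  [MeasurableSpace V] [BorelSpace V]

/-- Every linear map with positive determinant minimizes the energy with density `Φ` among its
compositions with the orientation-preserving diffeomorphisms of `V` that preserve `Ω`. -/
def IsStable (Ω : Set V) (Φ : (V →L[ℝ] V) → ℝ) : Prop :=
  ∀ A : V →L[ℝ] V, 0 < A.det → ∀ φ : V ≃ₜ V, ContDiff ℝ 1 φ → ContDiff ℝ 1 φ.symm →
    (∀ x, φ x ∈ Ω ↔ x ∈ Ω) → (∀ x, 0 < (fderiv ℝ φ x).det) →
      0 ≤ ∫ x in Ω, (Φ (A * fderiv ℝ φ x) - Φ A)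

/-- Change of variables, since `φ` maps `Ω` onto itself. Affine functions of the Jacobian therefore
drop out of the stability inequality. -/
theorem setIntegral_det_fderiv {Ω : Set V} (hΩ : IsOpen Ω) (φ : V ≃ₜ V)
    (hφ : ContDiff ℝ 1 φ) (hmem : ∀ x, φ x ∈ Ω ↔ x ∈ Ω) (hdet : ∀ x, 0 < (fderiv ℝ φ x).det) :
    ∫ x in Ω, (fderiv ℝ φ x).det = volume.real Ω := by
  have himg : φ '' Ω = Ω := by
    ext x
    constructor
    · rintro ⟨y, hy, rfl⟩
      exact (hmem y).2 hy
    · intro hx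
      exact ⟨φ.symm x, (hmem _).1 (by simpa using hx), by simp⟩
  have := integral_image_eq_integral_abs_det_fderiv_smul volume hΩ.measurableSet
    (fun x _ => ((hφ.differentiable one_ne_zero x).hasFDerivAt).hasFDerivWithinAt)
    φ.injective.injOn (fun _ => (1 : ℝ))
  rw [himg] at this
  simp only [smul_eq_mul, mul_one, setIntegral_const] at this
  rw [this]
  exact integral_congr_ae (Eventually.of_forall fun x => (abs_of_pos (hdet x)).symm)

theorem integrableOn_of_continuous {Ω : Set V} (hb : Bornology.IsBounded Ω) {f : V → ℝ}
    (hf : Continuous f) : IntegrableOn f Ω := by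
  obtain ⟨R, hR⟩ := hb.subset_closedBall 0
  exact (hf.continuousOn.integrableOn_compact (isCompact_closedBall 0 R)).mono_set hR

/-- A stable continuous function of the determinant is convex. -/
theorem IsStable.convexOn {Ω : Set V} (hΩ : IsOpen Ω) (hne : Ω.Nonempty)
    (hb : Bornology.IsBounded Ω) {Φ : (V →L[ℝ] V) → ℝ} (hst : IsStable Ω Φ) {h : ℝ → ℝ}
    (hh : ContinuousOn h (Ioi 0)) (hΦ : ∀ A : V →L[ℝ] V, 0 < A.det → Φ A = h A.det)
    {e : V} (he : ‖e‖ = 1) : ConvexOn ℝ (Ioi 0) h := by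
  refine LinearOrder.convexOn_of_lt (convex_Ioi 0) ?_
  intro x hx y hy hxy a b ha hb' hab
  by_contra! hlt
  have hx0 : 0 < x := hx
  have hy0 : 0 < y := hy
  set c := (h y - h x) / (y - x) with hc
  have hcy : c * (y - x) = h y - h x := by rw [hc]; field_simp [sub_ne_zero.2 hxy.ne']
  set k : ℝ → ℝ := fun s => h s - (h x + c * (s - x)) with hk
  have hIcc : Icc x y ⊆ Ioi 0 := fun s hs => hx0.trans_le hs.1
  have hkc : ContinuousOn k (Icc x y) := by
    have := hh.mono hIcc
    fun_prop
  have hkx : k x = 0 := by simp [hk]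
  have hky : k y = 0 := by simp only [hk]; linarith
  set m := a • x + b • y with hm
  have hmI : m ∈ Icc x y := by
    simp only [hm, smul_eq_mul]
    constructor <;> nlinarith
  have hkm : 0 < k m := by
    have h1 : m - x = b * (y - x) := by
      simp only [hm, smul_eq_mul]; linear_combination (x) * hab
    have h2 : c * (m - x) = b * (h y - h x) := by rw [h1, ← hcy]; ring
    simp only [hk]
    rw [h2]
    simp only [smul_eq_mul] at hlt
    have : a = 1 - b := by linarith
    rw [this] at hlt
    linarith
  obtain ⟨s, hs, hsmax⟩ := isCompact_Icc.exists_isMaxOn ⟨m, hmI⟩ hkc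
  -- Taking the last maximizer makes `k` strictly smaller everywhere to its right.
  obtain ⟨d, ⟨hd, hds⟩, hdmax⟩ :=
    (hkc.preimage_isClosed_of_isClosed isClosed_Icc (isClosed_singleton (x := k s)) |>
      isCompact_Icc.of_isClosed_subset <| inter_subset_left).exists_isGreatest ⟨s, hs, rfl⟩
  have hds : k d = k s := hds
  have hle : ∀ t ∈ Icc x y, k t ≤ k d := fun t ht => hds ▸ hsmax ht
  have hkd : 0 < k d := hkm.trans_le (hle m hmI)
  have hdlt : ∀ t ∈ Icc x y, d < t → k t < k d := by
    intro t ht hdt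
    refine lt_of_le_of_ne (hle t ht) fun heq => ?_
    have : t ≤ d := hdmax ⟨ht, heq.trans hds⟩
    linarith
  have hxd : x < d := lt_of_le_of_ne hd.1 (by rintro rfl; linarith)
  have hdy : d < y := lt_of_le_of_ne hd.2 (by rintro rfl; linarith)
  have hd0 : 0 < d := hx0.trans hxd
  -- As `‖bumpDeriv‖ ≤ 4`, the bound `1 / 8` gives a perturbation with derivative at most `1 / 2`;
  -- the other two keep `d` times the Jacobian in `[x, y]`.
  obtain ⟨t, ht0, ht8, htx, hty⟩ : ∃ t : ℝ, 0 < t ∧ t ≤ 1 / 8 ∧ d * (4 * t) ≤ d - x ∧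
      d * (4 * t) ≤ y - d := by
    refine ⟨min (1 / 8) (min ((d - x) / (4 * d)) ((y - d) / (4 * d))), ?_, min_le_left _ _, ?_, ?_⟩
    · have : 0 < d - x := by linarith
      have : 0 < y - d := by linarith
      positivity
    · have : min (1 / 8) (min ((d - x) / (4 * d)) ((y - d) / (4 * d))) ≤ (d - x) / (4 * d) :=
        (min_le_right _ _).trans (min_le_left _ _)
      rw [le_div_iff₀ (by positivity)] at this
      linarith
    · have : min (1 / 8) (min ((d - x) / (4 * d)) ((y - d) / (4 * d))) ≤ (y - d) / (4 * d) :=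
        (min_le_right _ _).trans (min_le_right _ _)
      rw [le_div_iff₀ (by positivity)] at this
      linarith
  obtain ⟨x₀, hx₀⟩ := hne
  obtain ⟨ρ, hρ, hball⟩ := Metric.nhds_basis_closedBall.mem_iff.1 (hΩ.mem_nhds hx₀)
  set w : V → V := fun x => ρ⁻¹ • (x - x₀) with hw
  set u : V → V := fun x => (t * ρ * bump (w x)) • e with hu
  have hw1 : ContDiff ℝ 1 w := by fun_prop
  have hu1 : ContDiff ℝ 1 u := by
    have := contDiff_bump.comp hw1
    exact ((contDiff_const (c := t * ρ)).mul this).smul contDiff_const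
  have hud : ∀ x, HasFDerivAt u ((bumpDeriv (w x)).smulRight (t • e)) x := by
    intro x
    have h1 : HasFDerivAt w (ρ⁻¹ • ContinuousLinearMap.id ℝ V) x :=
      ((hasFDerivAt_id x).sub_const x₀).const_smul ρ⁻¹
    have h2 := (((hasFDerivAt_bump (w x)).comp x h1).const_mul (t * ρ)).smul_const e
    refine h2.congr_fderiv ?_
    ext v
    simp [smul_smul]
    congr 1
    field_simp
  have hbd : ∀ x, ‖fderiv ℝ u x‖ ≤ 1 / 2 := by
    intro x
    rw [(hud x).fderiv, ContinuousLinearMap.norm_smulRight_apply, norm_smul, he, Real.norm_eq_abs,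
      abs_of_pos ht0]
    nlinarith [norm_bumpDeriv_le (w x), norm_nonneg (bumpDeriv (w x))]
  obtain ⟨φ, hφ, hφ1, hφ2⟩ := exists_homeomorph_id_add hu1 hbd
  have hφd : ∀ x, fderiv ℝ φ x = 1 + (bumpDeriv (w x)).smulRight (t • e) := by
    intro x
    have : (φ : V → V) = fun x => x + u x := funext hφ
    rw [this]
    exact ((hasFDerivAt_id x).add (hud x)).fderiv
  have hdet : ∀ x, (fderiv ℝ φ x).det = 1 + t * bumpDeriv (w x) e := by
    intro x
    rw [hφd, det_one_add_smulRight]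
    simp
  have hbe : ∀ x, |bumpDeriv (w x) e| ≤ 4 := fun x => by
    simpa [he] using abs_bumpDeriv_apply_le (w x) e
  have hdet0 : ∀ x, 0 < (fderiv ℝ φ x).det := by
    intro x
    rw [hdet]
    have := abs_le.1 (hbe x)
    nlinarith
  have hout : ∀ x, x ∉ Ω → φ x = x := by
    intro x hx
    have h1 : ρ ≤ ‖x - x₀‖ := by
      by_contra! hcon
      exact hx (hball (by simpa [dist_eq_norm] using hcon.le))
    have h2 : 1 ≤ ‖w x‖ := by
      rw [hw, norm_smul, norm_inv, Real.norm_of_nonneg hρ.le, inv_mul_eq_div, le_div_iff₀ hρ]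
      simpa using h1
    rw [hφ, hu]
    simp [bump_of_one_le_norm h2]
  have hmem : ∀ x, φ x ∈ Ω ↔ x ∈ Ω := by
    intro x
    constructor
    · intro hx
      by_contra hcon
      rw [hout x hcon] at hx
      exact hcon hx
    · intro hx
      by_contra hcon
      have := φ.injective (hout _ hcon)
      rw [this] at hcon
      exact hcon hx
  obtain ⟨A, hA⟩ := exists_det_eq e he d
  have hA0 : 0 < A.det := hA ▸ hd0
  have hint := hst A hA0 φ hφ1 hφ2 hmem hdet0
  have hDc : Continuous fun x => (fderiv ℝ φ x).det :=
    continuous_det.comp (hφ1.continuous_fderiv one_ne_zero)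
  have hmemI : ∀ z, d * (fderiv ℝ φ z).det ∈ Icc x y := by
    intro z
    rw [hdet]
    have h1 := abs_le.1 (hbe z)
    have h2 : d * (t * bumpDeriv (w z) e) ≤ d * (4 * t) :=
      mul_le_mul_of_nonneg_left (by nlinarith) hd0.le
    have h3 : d * (-(4 * t)) ≤ d * (t * bumpDeriv (w z) e) :=
      mul_le_mul_of_nonneg_left (by nlinarith) hd0.le
    constructor <;> linarith
  set q : V → ℝ := fun z => k (d * (fderiv ℝ φ z).det) - k d with hq
  have hqc : Continuous q :=
    (hkc.comp_continuous (continuous_const.mul hDc) hmemI).sub continuous_const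
  -- The chord contributes a multiple of the Jacobian minus one, whose integral is zero.
  have hqi : ∫ z in Ω, q z = ∫ z in Ω, (Φ (A * fderiv ℝ φ z) - Φ A) := by
    have h1 : ∀ z, Φ (A * fderiv ℝ φ z) - Φ A = q z + c * d * ((fderiv ℝ φ z).det - 1) := by
      intro z
      rw [hΦ A hA0, hΦ _ (by rw [clm_det_mul]; exact mul_pos hA0 (hdet0 z)), clm_det_mul, hA]
      simp only [hq, hk]
      ring
    have h2 : ∫ z in Ω, ((fderiv ℝ φ z).det - 1) = 0 := by
      rw [integral_sub (integrableOn_of_continuous hb hDc)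
        (integrableOn_of_continuous hb continuous_const), setIntegral_det_fderiv hΩ φ hφ1 hmem hdet0]
      simp
    simp_rw [h1]
    rw [integral_add (integrableOn_of_continuous hb hqc)
      (integrableOn_of_continuous hb (by fun_prop)), integral_const_mul, h2]
    simp
  have hq0 := eq_zero_of_setIntegral_nonneg hΩ hqc.continuousOn (integrableOn_of_continuous hb hqc)
    (fun z _ => sub_nonpos.2 (hle _ (hmemI z))) (hqi ▸ hint)
  -- Below the centre the bump increases along `e`, so the Jacobian exceeds one there and `q` would
  -- be strictly negative.
  set z := x₀ - (ρ / 2) • e with hz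
  have hzΩ : z ∈ Ω := by
    apply hball
    simp [hz, norm_smul, he, abs_of_pos hρ]
    linarith
  have hwz : w z = (-(1 / 2 : ℝ)) • e := by
    simp only [hw, hz, sub_sub_cancel_left, smul_neg, smul_smul, neg_smul]
    congr 2
    field_simp
  have hdz : 0 < bumpDeriv (w z) e := by
    rw [bumpDeriv_apply, hwz, norm_smul, real_inner_smul_left, real_inner_self_eq_norm_sq, he]
    norm_num
  have h1 := hdlt _ (hmemI z) (by rw [hdet]; nlinarith [mul_pos hd0 (mul_pos ht0 hdz)])
  have h2 := hq0 z hzΩ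
  simp only [hq] at h2
  linarith

end BoundarySliding

end

/-! ### Anisotropic blow-up at the boundary and the sliding diffeomorphism. -/

noncomputable section

namespace BoundarySliding

open Filter Topology

section Scaling

variable {V : Type*} [NormedAddCommGroup V] [InnerProductSpace ℝ V]

/-- The anisotropic scaling by `r` orthogonally to `e` and by `r ^ 2` along `e`. -/
def scaling (e : V) (r : ℝ) : V →L[ℝ] V :=
  r • (1 : V →L[ℝ] V) + (r ^ 2 - r) • (innerSL ℝ e).smulRight e

theorem scaling_apply (e : V) (r : ℝ) (z : V) :
    scaling e r z = r • z + ((r ^ 2 - r) * ⟪e, z⟫_ℝ) • e := by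
  simp [scaling, smul_smul]

theorem inner_scaling {e : V} (he : ‖e‖ = 1) (r : ℝ) (z : V) :
    ⟪e, scaling e r z⟫_ℝ = r ^ 2 * ⟪e, z⟫_ℝ := by
  rw [scaling_apply, inner_add_right, real_inner_smul_right, real_inner_smul_right,
    real_inner_self_eq_norm_sq, he]
  ring

theorem scaling_mul_scaling {e : V} (he : ‖e‖ = 1) (r s : ℝ) :
    scaling e r * scaling e s = scaling e (r * s) := by
  ext z
  rw [mul_apply_eq_comp, scaling_apply e r, inner_scaling he, scaling_apply,
    scaling_apply]
  module

theorem scaling_one (e : V) : scaling e 1 = 1 := by simp [scaling]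

theorem scaling_zero (e : V) : scaling e 0 = 0 := by simp [scaling]

theorem continuous_scaling (e : V) : Continuous (scaling e) := by
  unfold scaling
  fun_prop

theorem scaling_inv_apply {e : V} (he : ‖e‖ = 1) {r : ℝ} (hr : r ≠ 0) (z : V) :
    scaling e r (scaling e r⁻¹ z) = z := by
  rw [← mul_apply_eq_comp, scaling_mul_scaling he, mul_inv_cancel₀ hr, scaling_one]
  rfl

theorem inv_scaling_apply {e : V} (he : ‖e‖ = 1) {r : ℝ} (hr : r ≠ 0) (z : V) :
    scaling e r⁻¹ (scaling e r z) = z := by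
  rw [← mul_apply_eq_comp, scaling_mul_scaling he, inv_mul_cancel₀ hr, scaling_one]
  rfl

/-- Coordinates that flatten the graph of `k`, scaled around the point `w` of the hyperplane. -/
def blowupMap (e : V) (k : V → ℝ) (w : V) (r : ℝ) (z : V) : V :=
  w + scaling e r z + k (w + scaling e r z) • e

/-- The map `blowupMap` as a homeomorphism. -/
def blowupHomeomorph {e : V} (he : ‖e‖ = 1) {k : V → ℝ} (hkc : Continuous k)
    (hk : ∀ (z : V) (t : ℝ), k (z + t • e) = k z) (w : V) {r : ℝ} (hr : r ≠ 0) : V ≃ₜ V where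
  toFun := blowupMap e k w r
  invFun x := scaling e r⁻¹ (x - k x • e - w)
  left_inv z := by
    simp only [blowupMap]
    rw [hk]
    convert! inv_scaling_apply he hr z using 2
    abel
  right_inv x := by
    simp only [blowupMap]
    rw [scaling_inv_apply he hr]
    have h1 : w + (x - k x • e - w) = x + (-k x) • e := by module
    rw [h1, hk]
    module
  continuous_toFun := by unfold blowupMap; fun_prop
  continuous_invFun := by fun_prop

variable {e : V} {k : V → ℝ}

theorem fderiv_apply_of_invariant (hk1 : ContDiff ℝ 1 k)
    (hk : ∀ (z : V) (t : ℝ), k (z + t • e) = k z) (z : V) : fderiv ℝ k z e = 0 := by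
  have h1 : HasDerivAt (fun t : ℝ => k (z + t • e)) (fderiv ℝ k z e) 0 := by
    have h2 : HasDerivAt (fun t : ℝ => z + t • e) e 0 := by
      simpa using ((hasDerivAt_id (0 : ℝ)).smul_const e).const_add z
    have h3 : HasFDerivAt k (fderiv ℝ k z) (z + (0 : ℝ) • e) := by
      simpa using (hk1.differentiable one_ne_zero z).hasFDerivAt
    exact h3.comp_hasDerivAt 0 h2
  simp_rw [hk] at h1
  exact h1.unique (hasDerivAt_const _ _)

theorem fderiv_add_smul_of_invariant (hk : ∀ (z : V) (t : ℝ), k (z + t • e) = k z) (z : V) (t : ℝ) :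
    fderiv ℝ k (z + t • e) = fderiv ℝ k z := by
  rw [← fderiv_comp_add_right]
  simp_rw [hk]

theorem hasFDerivAt_blowupMap (hk1 : ContDiff ℝ 1 k) (w : V) (r : ℝ) (z : V) :
    HasFDerivAt (blowupMap e k w r)
      ((1 + (fderiv ℝ k (w + scaling e r z)).smulRight e) * scaling e r) z := by
  have h1 : HasFDerivAt (fun z => w + scaling e r z) (scaling e r) z :=
    ((scaling e r).hasFDerivAt).const_add w
  have h2 := (hk1.differentiable one_ne_zero (w + scaling e r z)).hasFDerivAt.comp z h1
  exact h1.add (h2.smul_const e)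

theorem hasFDerivAt_blowupHomeomorph_symm (he : ‖e‖ = 1) (hk1 : ContDiff ℝ 1 k)
    (hk : ∀ (z : V) (t : ℝ), k (z + t • e) = k z) (w : V) {r : ℝ} (hr : r ≠ 0) (x : V) :
    HasFDerivAt (blowupHomeomorph he hk1.continuous hk w hr).symm
      (scaling e r⁻¹ * (1 - (fderiv ℝ k x).smulRight e)) x := by
  have h1 := (hk1.differentiable one_ne_zero x).hasFDerivAt
  have h2 := ((hasFDerivAt_id x).sub (h1.smul_const e)).sub_const w
  exact ((scaling e r⁻¹).hasFDerivAt).comp x h2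

theorem contDiff_blowupMap (hk1 : ContDiff ℝ 1 k) (w : V) (r : ℝ) :
    ContDiff ℝ 1 (blowupMap e k w r) := by
  unfold blowupMap
  fun_prop

theorem contDiff_blowupHomeomorph_symm (he : ‖e‖ = 1) (hk1 : ContDiff ℝ 1 k)
    (hk : ∀ (z : V) (t : ℝ), k (z + t • e) = k z) (w : V) {r : ℝ} (hr : r ≠ 0) :
    ContDiff ℝ 1 (blowupHomeomorph he hk1.continuous hk w hr).symm := by
  change ContDiff ℝ 1 fun x => scaling e r⁻¹ (x - k x • e - w)
  fun_prop

theorem continuous_uncurry_blowupMap (hkc : Continuous k) (w : V) :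
    Continuous fun p : ℝ × V => blowupMap e k w p.1 p.2 := by
  have h1 : Continuous fun p : ℝ × V => scaling e p.1 p.2 :=
    ((continuous_scaling e).comp continuous_fst).clm_apply continuous_snd
  unfold blowupMap
  fun_prop

/-- The derivative, at the point with blow-up coordinates `z`, of the diffeomorphism which is
`z ↦ z + r * bump z • τ` in these coordinates. -/
def slidingDeriv (e : V) (k : V → ℝ) (w τ : V) (r : ℝ) (z : V) : V →L[ℝ] V :=
  (1 + (fderiv ℝ k (w + scaling e r (z + (r * bump z) • τ))).smulRight e) *
    (1 + (r • bumpDeriv z + ((1 - r) * bumpDeriv z e) • innerSL ℝ e).smulRight τ) *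
    (1 - (fderiv ℝ k (blowupMap e k w r z)).smulRight e)

/-- The conjugate of the inner derivative by `scaling e r` is written out in `slidingDeriv` with all
inverse powers of `r` cancelled. Hence continuity persists up to `r = 0`, where the blow-up itself
degenerates. -/
theorem continuous_uncurry_slidingDeriv (hk1 : ContDiff ℝ 1 k) (w τ : V) :
    Continuous fun p : ℝ × V => slidingDeriv e k w τ p.1 p.2 := by
  have h0 := hk1.continuous_fderiv one_ne_zero
  have h1 : Continuous fun p : ℝ × V => scaling e p.1 (p.2 + (p.1 * bump p.2) • τ) := by
    have := continuous_bump (V := V)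
    exact ((continuous_scaling e).comp continuous_fst).clm_apply (by fun_prop)
  have h2 : Continuous fun p : ℝ × V => fderiv ℝ k (blowupMap e k w p.1 p.2) :=
    h0.comp (continuous_uncurry_blowupMap hk1.continuous w)
  have h3 : Continuous fun p : ℝ × V =>
      fderiv ℝ k (w + scaling e p.1 (p.2 + (p.1 * bump p.2) • τ)) :=
    h0.comp (continuous_const.add h1)
  have h4 := continuous_bumpDeriv (V := V)
  have h5 : Continuous fun p : ℝ × V => p.1 • bumpDeriv p.2 +
      ((1 - p.1) * bumpDeriv p.2 e) • innerSL ℝ e := by fun_prop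
  have hs : ∀ v : V, Continuous fun m : V →L[ℝ] ℝ => m.smulRight v := fun v =>
    ((ContinuousLinearMap.smulRightL ℝ V V).flip v).continuous
  unfold slidingDeriv
  exact ((continuous_const.add ((hs e).comp h3)).mul (continuous_const.add ((hs τ).comp h5))).mul
    (continuous_const.sub ((hs e).comp h2))

theorem slidingDeriv_of_one_le_norm (hk1 : ContDiff ℝ 1 k)
    (hk : ∀ (z : V) (t : ℝ), k (z + t • e) = k z) (w τ : V) (r : ℝ) {z : V} (hz : 1 ≤ ‖z‖) :
    slidingDeriv e k w τ r z = 1 := by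
  have h0 := fderiv_apply_of_invariant hk1 hk
  ext v
  simp only [slidingDeriv, bump_of_one_le_norm hz, bumpDeriv_of_one_le_norm hz, blowupMap]
  rw [fderiv_add_smul_of_invariant hk]
  simp [h0]

/-- At `r = 0` all base points collapse to `x`. What remains is a shear parallel to the hyperplane,
conjugated by the flattening of the tangent plane. -/
theorem slidingDeriv_zero {x τ : V} (hk : ∀ (z : V) (t : ℝ), k (z + t • e) = k z) (z : V) :
    slidingDeriv e k (x - k x • e) τ 0 z = (1 + (fderiv ℝ k x).smulRight e) *
      (1 + (bumpDeriv z e • innerSL ℝ e).smulRight τ) * (1 - (fderiv ℝ k x).smulRight e) := by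
  have h1 : x - k x • e = x + (-k x) • e := by module
  simp only [slidingDeriv, blowupMap, scaling_zero, h1]
  simp [fderiv_add_smul_of_invariant hk, hk, -neg_smul]

/-- The outer factors have determinant one because `k` is constant along `e`, and the normal part of
the middle factor drops out because `τ ⊥ e`. -/
theorem det_slidingDeriv [FiniteDimensional ℝ V] (hk1 : ContDiff ℝ 1 k)
    (hk : ∀ (z : V) (t : ℝ), k (z + t • e) = k z) (w : V) {τ : V} (hτ : ⟪e, τ⟫_ℝ = 0)
    (r : ℝ) (z : V) : (slidingDeriv e k w τ r z).det = 1 + r * bumpDeriv z τ := by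
  have h0 := fderiv_apply_of_invariant hk1 hk
  have h1 : ∀ x, (1 - (fderiv ℝ k x).smulRight e) = 1 + (-fderiv ℝ k x).smulRight e := by
    intro x; ext v; simp [sub_eq_add_neg]
  rw [slidingDeriv, clm_det_mul, clm_det_mul, h1]
  simp only [det_one_add_smulRight]
  simp [h0, hτ]

end Scaling

variable {V : Type*} [NormedAddCommGroup V] [InnerProductSpace ℝ V] [FiniteDimensional ℝ V]
  [MeasurableSpace V] [BorelSpace V]

/-- The open half of the unit ball below the hyperplane orthogonal to `e`. -/
def halfBall {V : Type*} [NormedAddCommGroup V] [InnerProductSpace ℝ V] (e : V) : Set V :=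
  {z | z ∈ Metric.ball 0 1 ∧ ⟪e, z⟫_ℝ < 0}

theorem isOpen_halfBall {V : Type*} [NormedAddCommGroup V] [InnerProductSpace ℝ V] (e : V) :
    IsOpen (halfBall e) :=
  Metric.isOpen_ball.inter (isOpen_lt (innerSL ℝ e).continuous continuous_const)

theorem isBounded_halfBall {V : Type*} [NormedAddCommGroup V] [InnerProductSpace ℝ V] (e : V) :
    Bornology.IsBounded (halfBall e) := Metric.isBounded_ball.subset inter_subset_left

/-- The stability inequality for a diffeomorphism sliding `Ω` along its boundary, in the blow-up
coordinates. -/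
theorem IsStable.setIntegral_slidingDeriv_nonneg {Ω : Set V} (hΩ : IsOpen Ω)
    {Φ : (V →L[ℝ] V) → ℝ} (hst : IsStable Ω Φ) {e : V} (he : ‖e‖ = 1) {k : V → ℝ}
    (hk1 : ContDiff ℝ 1 k) (hk : ∀ (z : V) (t : ℝ), k (z + t • e) = k z) {w : V}
    (hw : ⟪e, w⟫_ℝ = 0) {τ : V} (hτ : ⟪e, τ⟫_ℝ = 0) {r : ℝ} (hr : 0 < r)
    (hrτ : r * ‖τ‖ ≤ 1 / 8)
    (hmem : ∀ z ∈ Metric.closedBall (0 : V) 2, blowupMap e k w r z ∈ Ω ↔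
      ⟪e, blowupMap e k w r z⟫_ℝ < k (blowupMap e k w r z))
    {B : V →L[ℝ] V} (hB : 0 < B.det) :
    0 ≤ ∫ z in halfBall e, (Φ (B * slidingDeriv e k w τ r z) - Φ B) := by
  set T := blowupHomeomorph he hk1.continuous hk w hr.ne' with hT
  have hTa : ∀ z, T z = blowupMap e k w r z := fun z => rfl
  have hT' : (T : V → V) = blowupMap e k w r := rfl
  set u : V → V := fun z => (r * bump z) • τ with hu
  have hu1 : ContDiff ℝ 1 u := (contDiff_const.mul contDiff_bump).smul contDiff_const
  have hud : ∀ z, HasFDerivAt u ((r • bumpDeriv z).smulRight τ) z := fun z =>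
    ((hasFDerivAt_bump z).const_mul r).smul_const τ
  -- The derivative of `u` is at most `4 * r * ‖τ‖ ≤ 1 / 2`, whence the constant `1 / 8`.
  obtain ⟨ψ, hψ, hψ1, hψ2⟩ := exists_homeomorph_id_add hu1 fun z => by
    rw [(hud z).fderiv, ContinuousLinearMap.norm_smulRight_apply, norm_smul, Real.norm_eq_abs,
      abs_of_pos hr]
    nlinarith [norm_bumpDeriv_le z, norm_nonneg (bumpDeriv z), norm_nonneg τ]
  have hψd : ∀ z, HasFDerivAt ψ (1 + (r • bumpDeriv z).smulRight τ) z := by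
    intro z
    rw [show (ψ : V → V) = fun x => x + u x from funext hψ]
    exact (hasFDerivAt_id z).add (hud z)
  set φ : V ≃ₜ V := T.symm.trans (ψ.trans T) with hφ
  have hφa : ∀ z, φ (T z) = T (ψ z) := fun z => by simp [hφ]
  have hT1 : ContDiff ℝ 1 T := contDiff_blowupMap hk1 w r
  have hT2 : ContDiff ℝ 1 T.symm := contDiff_blowupHomeomorph_symm he hk1 hk w hr.ne'
  have hφ1 : ContDiff ℝ 1 φ := hT1.comp (hψ1.comp hT2)
  have hφ2 : ContDiff ℝ 1 φ.symm := hT1.comp (hψ2.comp hT2)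
  have hφd : ∀ z, fderiv ℝ φ (T z) = slidingDeriv e k w τ r z := by
    intro z
    have h1 := hasFDerivAt_blowupHomeomorph_symm he hk1 hk w hr.ne' (T z)
    have h2 : HasFDerivAt ψ (1 + (r • bumpDeriv z).smulRight τ) (T.symm (T z)) := by
      simpa using hψd z
    have h3 : HasFDerivAt T ((1 + (fderiv ℝ k (w + scaling e r (ψ z))).smulRight e) * scaling e r)
        (ψ (T.symm (T z))) := by
      rw [T.symm_apply_apply]
      exact hasFDerivAt_blowupMap hk1 w r (ψ z)
    have h4 := HasFDerivAt.comp (g := T) (f := ψ ∘ T.symm) (T z) h3 (h2.comp (T z) h1)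
    rw [show fderiv ℝ φ (T z) = _ from h4.fderiv, slidingDeriv,
      show z + (r * bump z) • τ = ψ z from (hψ z).symm, ← hTa]
    change ((1 + _) * scaling e r) * ((1 + _) * (scaling e r⁻¹ * (1 - _))) = _
    rw [← mul_assoc, ← mul_assoc]
    congr 1
    rw [mul_assoc, mul_assoc]
    congr 1
    ext v
    simp only [mul_apply_eq_comp, add_apply,
      one_apply_eq_self, ContinuousLinearMap.smulRight_apply,
      smul_apply, map_add, map_smul, scaling_inv_apply he hr.ne',
      innerSL_apply_apply, smul_eq_mul]
    -- Since `τ ⊥ e`, it is scaled only by `r`; with the explicit factor `r` this absorbs the `r⁻¹ ^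
    -- 2` of the inverse scaling along `e`.
    rw [scaling_apply e r τ, hτ, scaling_apply e r⁻¹ v]
    simp only [map_add, map_smul, smul_eq_mul, mul_zero, zero_smul, add_zero, smul_smul]
    congr 2
    field_simp
  have hinner : ∀ z, ⟪e, T z⟫_ℝ < k (T z) ↔ ⟪e, z⟫_ℝ < 0 := by
    intro z
    have h1 : k (T z) = k (w + scaling e r z) := by rw [hTa, blowupMap, hk]
    have h2 : ⟪e, T z⟫_ℝ = r ^ 2 * ⟪e, z⟫_ℝ + k (w + scaling e r z) := by
      rw [hTa, blowupMap, inner_add_right, inner_add_right, hw, inner_scaling he,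
        real_inner_smul_right, real_inner_self_eq_norm_sq, he]
      ring
    rw [h1, h2]
    constructor
    · intro h; have := pow_pos hr 2; by_contra! hc; nlinarith
    · intro h; have := pow_pos hr 2; nlinarith
  have hmem' : ∀ z, ‖z‖ ≤ 2 → (T z ∈ Ω ↔ ⟪e, z⟫_ℝ < 0) := fun z hz =>
    (hmem z (by simpa using hz)).trans (hinner z)
  have hφΩ : ∀ x, φ x ∈ Ω ↔ x ∈ Ω := by
    intro x
    obtain ⟨z, rfl⟩ := T.surjective x
    rw [hφa]
    -- Outside the unit ball `ψ` is the identity. Inside, points stay within radius 2, where the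
    -- local description of `Ω` applies, and `τ ⊥ e` preserves the sign of the height.
    rcases le_total 1 ‖z‖ with hz | hz
    · have : ψ z = z := by rw [hψ, hu]; simp [bump_of_one_le_norm hz]
      rw [this]
    · have h1 : ‖ψ z‖ ≤ 2 := by
        rw [hψ]
        refine (norm_add_le _ _).trans ?_
        have : ‖u z‖ ≤ 1 := by
          rw [hu, norm_smul, norm_mul, Real.norm_of_nonneg hr.le,
            Real.norm_of_nonneg (bump_nonneg z)]
          nlinarith [bump_le_one z, bump_nonneg z, mul_nonneg hr.le (norm_nonneg τ)]
        linarith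
      rw [hmem' _ h1, hmem' _ (by linarith), hψ, hu, inner_add_right, real_inner_smul_right, hτ]
      simp
  have hdet : ∀ x, 0 < (fderiv ℝ φ x).det := by
    intro x
    obtain ⟨z, rfl⟩ := T.surjective x
    rw [hφd, det_slidingDeriv hk1 hk w hτ]
    have := abs_le.1 (abs_bumpDeriv_apply_le z τ)
    nlinarith
  have hint := hst B hB φ hφ1 hφ2 hφΩ hdet
  have himg : T '' halfBall e ⊆ Ω := by
    rintro _ ⟨z, ⟨hz, hz'⟩, rfl⟩
    refine (hmem' z ?_).2 hz'
    have : ‖z‖ < 1 := by simpa using hz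
    linarith
  have hopen : IsOpen (halfBall e) := isOpen_halfBall e
  -- Off the image of the half-ball the integrand vanishes. The Jacobian of `T` is constant, so it
  -- factors out of the transformed integral.
  rw [setIntegral_eq_of_subset_of_forall_sdiff_eq_zero hΩ.measurableSet himg, hT',
    integral_image_eq_integral_abs_det_fderiv_smul volume hopen.measurableSet
      (fun z _ => (hasFDerivAt_blowupMap hk1 w r z).hasFDerivWithinAt) T.injective.injOn] at hint
  · have hdetT : ∀ z, ((1 + (fderiv ℝ k (w + scaling e r z)).smulRight e) * scaling e r).det =
        (scaling e r).det := by
      intro z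
      rw [clm_det_mul, det_one_add_smulRight, fderiv_apply_of_invariant hk1 hk]
      simp
    have hS : (scaling e r).det ≠ 0 := by
      intro h0
      have h1 : (scaling e r * scaling e r⁻¹).det = 1 := by
        rw [scaling_mul_scaling he, mul_inv_cancel₀ hr.ne', scaling_one]
        exact LinearMap.det_id
      rw [clm_det_mul, h0, zero_mul] at h1
      exact zero_ne_one h1
    simp only [hdetT, smul_eq_mul] at hint
    rw [integral_const_mul] at hint
    have h3 : ∀ z, fderiv ℝ φ (blowupMap e k w r z) = slidingDeriv e k w τ r z := hφd
    simp only [h3] at hint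
    exact nonneg_of_mul_nonneg_right hint (abs_pos.2 hS)
  · rintro x ⟨hx, hx'⟩
    obtain ⟨z, rfl⟩ := T.surjective x
    have hz : 1 ≤ ‖z‖ := by
      by_contra! hz
      exact hx' ⟨z, ⟨by simpa using hz, (hmem' z (by linarith)).1 hx⟩, rfl⟩
    rw [hφd, slidingDeriv_of_one_le_norm hk1 hk w τ r hz, mul_one, sub_self]

end BoundarySliding

end

/-! ### The blow-up limit and invariance under tangential shears. -/

noncomputable section

namespace BoundarySliding

open Filter Topology

variable {V : Type*} [NormedAddCommGroup V] [InnerProductSpace ℝ V] [FiniteDimensional ℝ V]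
  [MeasurableSpace V] [BorelSpace V]

/-- The limit of the stability inequality under blow-up at a boundary point. -/
theorem IsStable.setIntegral_slidingDeriv_zero_nonneg {Ω : Set V} (hΩ : IsOpen Ω)
    {Φ : (V →L[ℝ] V) → ℝ} (hst : IsStable Ω Φ) (hΦ : ContinuousOn Φ {A | 0 < A.det}) {e : V}
    (he : ‖e‖ = 1) {k : V → ℝ} (hk1 : ContDiff ℝ 1 k)
    (hk : ∀ (z : V) (t : ℝ), k (z + t • e) = k z) {x : V} (hx : ⟪e, x⟫_ℝ = k x) {ε : ℝ}
    (hε : 0 < ε) (hmem : ∀ z ∈ Metric.ball x ε, z ∈ Ω ↔ ⟪e, z⟫_ℝ < k z) {τ : V}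
    (hτ : ⟪e, τ⟫_ℝ = 0) {B : V →L[ℝ] V} (hB : 0 < B.det) :
    0 ≤ ∫ z in halfBall e, (Φ (B * slidingDeriv e k (x - k x • e) τ 0 z) - Φ B) := by
  set w := x - k x • e with hw
  have hew : ⟪e, w⟫_ℝ = 0 := by
    rw [hw, inner_sub_right, real_inner_smul_right, real_inner_self_eq_norm_sq, he, hx]
    ring
  obtain ⟨ρ, hρ, hρτ⟩ : ∃ ρ : ℝ, 0 < ρ ∧ ρ * ‖τ‖ ≤ 1 / 8 := by
    refine ⟨1 / (8 * (‖τ‖ + 1)), by positivity, ?_⟩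
    rw [div_mul_eq_mul_div, div_le_div_iff₀ (by positivity) (by norm_num)]
    linarith
  have hcont : Continuous fun p : ℝ × V => B * slidingDeriv e k w τ p.1 p.2 :=
    continuous_const.mul (continuous_uncurry_slidingDeriv hk1 w τ)
  have hdet : ∀ r ∈ Icc 0 ρ, ∀ z, 0 < (B * slidingDeriv e k w τ r z).det := by
    intro r hr z
    rw [clm_det_mul, det_slidingDeriv hk1 hk w hτ]
    refine mul_pos hB ?_
    have h1 := abs_le.1 (abs_bumpDeriv_apply_le z τ)
    have h2 : r * ‖τ‖ ≤ ρ * ‖τ‖ := by gcongr; exact hr.2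
    have h3 : r * bumpDeriv z τ ≥ r * (-(4 * ‖τ‖)) := mul_le_mul_of_nonneg_left h1.1 hr.1
    nlinarith
  have hΦc : ContinuousOn (fun p : ℝ × V => Φ (B * slidingDeriv e k w τ p.1 p.2) - Φ B)
      (Icc 0 ρ ×ˢ univ) :=
    (hΦ.comp hcont.continuousOn fun p hp => hdet p.1 hp.1 p.2).sub continuousOn_const
  obtain ⟨C, hC⟩ := (isCompact_Icc.prod (isCompact_closedBall (0 : V) 1)).exists_bound_of_continuousOn
    (hΦc.mono (prod_mono_right (subset_univ _)))
  have hΦz : ∀ r ∈ Icc 0 ρ, Continuous fun z => Φ (B * slidingDeriv e k w τ r z) - Φ B := by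
    intro r hr
    exact hΦc.comp_continuous (f := fun z => (r, z)) (by fun_prop) fun z => ⟨hr, mem_univ _⟩
  have hIcc : ∀ᶠ r in 𝓝[>] (0 : ℝ), r ∈ Icc 0 ρ := by
    filter_upwards [Ioo_mem_nhdsGT hρ] with r hr
    exact ⟨hr.1.le, hr.2.le⟩
  have hlim : Tendsto
      (fun r => ∫ z in halfBall e, (Φ (B * slidingDeriv e k w τ r z) - Φ B)) (𝓝[>] 0)
      (𝓝 (∫ z in halfBall e, (Φ (B * slidingDeriv e k w τ 0 z) - Φ B))) := by
    refine tendsto_integral_filter_of_dominated_convergence (fun _ => C) ?_ ?_ ?_ ?_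
    · filter_upwards [hIcc] with r hr
      exact (hΦz r hr).aestronglyMeasurable
    · filter_upwards [hIcc] with r hr
      filter_upwards [ae_restrict_mem (isOpen_halfBall e).measurableSet] with z hz
      exact hC (r, z) ⟨hr, Metric.ball_subset_closedBall hz.1⟩
    · exact integrableOn_of_continuous (isBounded_halfBall e) continuous_const
    · refine Eventually.of_forall fun z => ?_
      have h1 : ContinuousOn (fun r => Φ (B * slidingDeriv e k w τ r z) - Φ B) (Icc 0 ρ) :=
        hΦc.comp (f := fun r => (r, z)) (by fun_prop) fun r hr => ⟨hr, mem_univ _⟩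
      have h2 := h1 0 ⟨le_rfl, hρ.le⟩
      exact h2.tendsto.mono_left (nhdsWithin_le_iff.2 hIcc)
  refine ge_of_tendsto hlim ?_
  -- At `r = 0` the blow-up map is constantly `x`; compactness makes the nearby statement uniform in
  -- `z`.
  have hball : ∀ᶠ r in 𝓝 (0 : ℝ), ∀ z ∈ Metric.closedBall (0 : V) 2,
      blowupMap e k w r z ∈ Metric.ball x ε := by
    refine (isCompact_closedBall (0 : V) 2).eventually_forall_of_forall_eventually fun z _ => ?_
    refine (continuous_uncurry_blowupMap hk1.continuous w).continuousAt.eventually_mem ?_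
    have : blowupMap e k w 0 z = x := by
      have h1 : w = x + (-k x) • e := by rw [hw]; module
      simp only [blowupMap, scaling_zero, zero_apply, add_zero]
      rw [h1, hk]
      module
    simp only [this]
    exact Metric.ball_mem_nhds x hε
  filter_upwards [hIcc, self_mem_nhdsWithin, nhdsWithin_le_nhds hball] with r hr hr0 hrb
  refine hst.setIntegral_slidingDeriv_nonneg hΩ he hk1 hk hew hτ hr0 ?_
    (fun z hz => hmem _ (hrb z hz)) hB
  exact (mul_le_mul_of_nonneg_right hr.2 (norm_nonneg τ)).trans hρτ

/-- A stable continuous density is invariant under the shears along the tangent plane at a `C¹`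
boundary point. -/
theorem IsStable.apply_mul_shear {Ω : Set V} (hΩ : IsOpen Ω)
    {Φ : (V →L[ℝ] V) → ℝ} (hst : IsStable Ω Φ) (hΦ : ContinuousOn Φ {A | 0 < A.det}) {e : V}
    (he : ‖e‖ = 1) {k : V → ℝ} (hk1 : ContDiff ℝ 1 k)
    (hk : ∀ (z : V) (t : ℝ), k (z + t • e) = k z) {x : V} (hx : ⟪e, x⟫_ℝ = k x) {ε : ℝ}
    (hε : 0 < ε) (hmem : ∀ z ∈ Metric.ball x ε, z ∈ Ω ↔ ⟪e, z⟫_ℝ < k z) {σ : V}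
    (hσ : (innerSL ℝ e - fderiv ℝ k x) σ = 0) {B : V →L[ℝ] V} (hB : 0 < B.det) :
    Φ (B * (1 + (innerSL ℝ e - fderiv ℝ k x).smulRight σ)) = Φ B := by
  set m := innerSL ℝ e - fderiv ℝ k x with hm
  have hke := fderiv_apply_of_invariant hk1 hk x
  have hσ' : ⟪e, σ⟫_ℝ = fderiv ℝ k x σ := by
    simpa [hm, sub_eq_zero] using hσ
  have hdet : ∀ t : ℝ, 0 < (B * (1 + t • m.smulRight σ)).det := by
    intro t
    have : t • m.smulRight σ = (t • m).smulRight σ := by ext; simp [smul_smul]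
    rw [clm_det_mul, this, det_one_add_smulRight]
    simpa [hσ] using hB
  have hg : Continuous fun t : ℝ => Φ (B * (1 + t • m.smulRight σ)) :=
    hΦ.comp_continuous (by fun_prop) hdet
  have hz : (-(1 / 2 : ℝ)) • e ∈ halfBall e := by
    refine ⟨?_, ?_⟩
    · simp only [Metric.mem_ball, dist_zero_right, norm_smul, he]
      norm_num
    · rw [real_inner_smul_right, real_inner_self_eq_norm_sq, he]
      norm_num
  -- The decisive sign: in the lower half-ball, moving along `e` increases the radial bump. On the
  -- full ball the derivative would change sign.
  have hp0 : ∀ z ∈ halfBall e, 0 ≤ bumpDeriv z e := by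
    intro z hz
    rw [bumpDeriv_apply, real_inner_comm]
    nlinarith [mul_nonneg (le_max_left 0 (1 - ‖z‖ ^ 2)) (neg_nonneg.2 hz.2.le)]
  have hpz : 0 < bumpDeriv ((-(1 / 2 : ℝ)) • e) e := by
    rw [bumpDeriv_apply, norm_smul, real_inner_smul_left, real_inner_self_eq_norm_sq, he]
    norm_num
  have hfin : volume (halfBall e) ≠ ⊤ := (isBounded_halfBall e).measure_lt_top.ne
  have := eq_of_forall_setIntegral_nonneg (isOpen_halfBall e) hfin
    (continuous_bumpDeriv.clm_apply continuous_const) (P := 4) (p := fun z => bumpDeriv z e)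
    (fun z => by simpa [he] using (abs_le.1 (abs_bumpDeriv_apply_le z e)).2) hp0 hz hpz hg
    (fun a l => ?_) 1 0
  · simpa using this
  -- Slide along the horizontal part of `l • σ`. Undoing the flattening restores the `e`-component,
  -- because `m σ = 0` says `⟪e, σ⟫ = fderiv ℝ k x σ`, and turns `⟪e, ·⟫` into `m`.
  · have hτ : ⟪e, l • (σ - ⟪e, σ⟫_ℝ • e)⟫_ℝ = 0 := by
      rw [real_inner_smul_right, inner_sub_right, real_inner_smul_right,
        real_inner_self_eq_norm_sq, he]
      ring
    have h1 := hst.setIntegral_slidingDeriv_zero_nonneg hΩ hΦ he hk1 hk hx hε hmem hτ (hdet a)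
    -- Nilpotency makes the shear parameters add under composition.
    have hσσ : m.smulRight σ * m.smulRight σ = 0 := by
      ext v; simp [hσ]
    have h2 : ∀ z, B * (1 + a • m.smulRight σ) *
        slidingDeriv e k (x - k x • e) (l • (σ - ⟪e, σ⟫_ℝ • e)) 0 z =
        B * (1 + (a + l * bumpDeriv z e) • m.smulRight σ) := by
      intro z
      have h3 : slidingDeriv e k (x - k x • e) (l • (σ - ⟪e, σ⟫_ℝ • e)) 0 z =
          1 + (l * bumpDeriv z e) • m.smulRight σ := by
        rw [slidingDeriv_zero hk]
        ext v
        simp [hm, hke, he, hσ', inner_sub_right, real_inner_smul_right]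
        module
      rw [h3, mul_assoc]
      congr 1
      rw [mul_add, add_mul, add_mul, smul_mul_smul_comm, hσσ]
      simp only [mul_one, one_mul, smul_zero, add_zero, add_smul]
      abel
    simpa only [h2] using h1

end BoundarySliding

end

/-! ### Shears along spanning normals generate the special linear group. -/

noncomputable section

namespace BoundarySliding

open Filter Topology Matrix

section Algebra

/-- The special linear group over a field is generated by transvections. -/
theorem specialLinearGroup_transvection_induction {ι F : Type*} [Fintype ι] [DecidableEq ι]
    [Nontrivial ι] [Field F] (p : Matrix.SpecialLinearGroup ι F → Prop) (S : Matrix.SpecialLinearGroup ι F)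
    (htransvec : ∀ (i j : ι) (hij : i ≠ j) (a : F), p (Matrix.SpecialLinearGroup.transvection hij a))
    (hmul : ∀ A B, p A → p B → p (A * B)) : p S := by
  refine Matrix.SpecialLinearGroup.diagonal_transvection_induction' p S ?_ htransvec hmul
  intro i j hij c hc
  -- Whitehead's factorization of `diag(c, c⁻¹)` as `w(c) w(-1)`, where `w(c)` is a product of three
  -- transvections and the two adjacent middle ones are merged.
  have h1 : Matrix.SpecialLinearGroup.diag2n hij c hc =
      Matrix.SpecialLinearGroup.transvection hij c * Matrix.SpecialLinearGroup.transvection hij.symm (-c⁻¹) *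
        Matrix.SpecialLinearGroup.transvection hij (c - 1) * Matrix.SpecialLinearGroup.transvection hij.symm 1 *
        Matrix.SpecialLinearGroup.transvection hij (-1) := by
    apply Subtype.ext
    simp only [Matrix.SpecialLinearGroup.coe_mul, Matrix.SpecialLinearGroup.transvection_coe,
      Matrix.SpecialLinearGroup.diag2n_coe]
    have hd : (diagonal fun k => if k = i then c else if k = j then c⁻¹ else 1 : Matrix ι ι F) =
        1 + single i i (c - 1) + single j j (c⁻¹ - 1) := by
      ext k l
      by_cases hkl : k = l
      · subst hkl
        by_cases hki : k = i
        · subst hki; simp [single, hij.symm]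
        · by_cases hkj : k = j
          · subst hkj; simp [single, hij, hij.symm]
          · simp [single, hki, hkj, Ne.symm hki, Ne.symm hkj]
      · have h1 : ¬(i = k ∧ i = l) := by rintro ⟨rfl, rfl⟩; exact hkl rfl
        have h2 : ¬(j = k ∧ j = l) := by rintro ⟨rfl, rfl⟩; exact hkl rfl
        simp [single, hkl, h1, h2]
    rw [hd]
    simp [mul_add, add_mul, hij, hij.symm, hc]
    have hcc : c⁻¹ * (c - 1) = 1 - c⁻¹ := by rw [mul_sub, inv_mul_cancel₀ hc, mul_one]
    obtain ⟨f, hf⟩ : ∃ f : ι → ι → Matrix ι ι F, ∀ a b x, single a b x = x • f a b :=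
      ⟨fun a b => single a b 1, by simp⟩
    simp only [hcc, hf]
    module
  rw [h1]
  exact hmul _ _ (hmul _ _ (hmul _ _ (hmul _ _ (htransvec _ _ _ _) (htransvec _ _ _ _))
    (htransvec _ _ _ _)) (htransvec _ _ _ _)) (htransvec _ _ _ _)

/-- A function on the matrices of positive determinant which is invariant under the shears
`1 + v ⊗ νᵢ` with `v ⊥ νᵢ`, for a spanning family `ν`, depends only on the determinant. -/
theorem eq_of_det_eq_of_shear_invariant {n : ℕ} (hn : 1 < n)
    {Ψ : Matrix (Fin n) (Fin n) ℝ → ℝ} {ν : Fin n → E n}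
    (hν : Submodule.span ℝ (range ν) = ⊤)
    (h : ∀ i, ∀ M ∈ MatPos n, ∀ v : Fin n → ℝ, v ⬝ᵥ WithLp.ofLp (ν i) = 0 →
      Ψ (M * (1 + vecMulVec v (WithLp.ofLp (ν i)))) = Ψ M)
    {A A' : Matrix (Fin n) (Fin n) ℝ} (hA : A ∈ MatPos n) (hdet : A.det = A'.det) :
    Ψ A' = Ψ A := by
  have : Nontrivial (Fin n) := Fin.nontrivial_iff_two_le.2 hn
  -- With the normals as rows of `P`, conjugating the `(i, j)` transvection by `P` gives a shear `1
  -- + v ⊗ νⱼ`, with `v ⊥ νⱼ` because `i ≠ j`.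
  set P : Matrix (Fin n) (Fin n) ℝ := of fun i => WithLp.ofLp (ν i) with hP
  have hli : LinearIndependent ℝ fun i => WithLp.ofLp (ν i) := by
    have h1 : LinearIndependent ℝ ν :=
      linearIndependent_of_top_le_span_of_card_eq_finrank hν.ge (by simp)
    exact h1.map' (WithLp.linearEquiv 2 ℝ (Fin n → ℝ)).toLinearMap (LinearEquiv.ker _)
  have hPu : IsUnit P := linearIndependent_rows_iff_isUnit.1 hli
  have hPd : IsUnit P.det := (isUnit_iff_isUnit_det P).1 hPu
  have hPP : P * P⁻¹ = 1 := mul_nonsing_inv P hPd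
  have hPP' : P⁻¹ * P = 1 := nonsing_inv_mul P hPd
  have hAu : IsUnit A.det := isUnit_iff_ne_zero.2 (ne_of_gt hA)
  have key : ∀ S : Matrix.SpecialLinearGroup (Fin n) ℝ, ∀ M ∈ MatPos n,
      Ψ (M * (P⁻¹ * S.1 * P)) = Ψ M := by
    intro S
    refine specialLinearGroup_transvection_induction
      (fun S => ∀ M ∈ MatPos n, Ψ (M * (P⁻¹ * S.1 * P)) = Ψ M) S ?_ ?_
    · intro i j hij a M hM
      have h1 : P⁻¹ * (Matrix.SpecialLinearGroup.transvection hij a : Matrix.SpecialLinearGroup (Fin n) ℝ).1 * P =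
          1 + vecMulVec (P⁻¹ *ᵥ Pi.single i a) (WithLp.ofLp (ν j)) := by
        rw [Matrix.SpecialLinearGroup.transvection_coe, mul_add, add_mul, mul_one, hPP',
          ← mul_vecMulVec]
        congr 1
        rw [mul_assoc]
        congr 1
        ext k l
        by_cases hik : i = k <;>
        rw [vecMulVec_apply] <;>
        simp [single, Matrix.mul_apply, hP, hik, eq_comm]
      rw [h1]
      refine h j M hM _ ?_
      have : (P *ᵥ (P⁻¹ *ᵥ Pi.single i a)) j = 0 := by
        rw [mulVec_mulVec, hPP, one_mulVec, Pi.single_eq_of_ne hij.symm]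
      rw [dotProduct_comm]
      exact this
    · intro S T hS hT M hM
      have h1 : M * (P⁻¹ * (S * T : Matrix.SpecialLinearGroup (Fin n) ℝ).1 * P) =
          M * (P⁻¹ * S.1 * P) * (P⁻¹ * T.1 * P) := by
        simp only [Matrix.SpecialLinearGroup.coe_mul, mul_assoc]
        rw [← mul_assoc P P⁻¹, hPP, one_mul]
      have h2 : (P⁻¹ * S.1 * P).det = 1 := by
        rw [Matrix.det_mul, mul_comm, ← Matrix.det_mul, ← mul_assoc, hPP, one_mul, S.2]
      rw [h1, hT _ (by rw [MatPos, mem_ofPred_eq, Matrix.det_mul, h2, mul_one]; exact hM), hS M hM]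
  -- This element of `SL(n)` is chosen so that its conjugate by `P` carries `A` to `A'`.
  have hR : (P * (A⁻¹ * A') * P⁻¹).det = 1 := by
    rw [Matrix.det_mul, mul_comm, ← Matrix.det_mul, ← mul_assoc, hPP', one_mul, det_mul, ← hdet,
      ← Matrix.det_mul, nonsing_inv_mul A hAu, det_one]
  have := key ⟨_, hR⟩ A hA
  rw [← this]
  congr 1
  simp only [mul_assoc, hPP', mul_one]
  rw [← mul_assoc P⁻¹ P, hPP', one_mul, ← mul_assoc, mul_nonsing_inv A hAu, one_mul]

end Algebra

end BoundarySliding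

end

/-! ### Jensen's inequality, and passage between matrices and linear maps. -/

noncomputable section

namespace BoundarySliding

open Filter Topology Matrix

theorem _root_.ConvexOn.exists_subgradient {s : Set ℝ} {h : ℝ → ℝ} (hh : ConvexOn ℝ s h) {d : ℝ}
    (hd : d ∈ interior s) : ∃ c : ℝ, ∀ t ∈ s, h d + c * (t - d) ≤ h t := by
  refine ⟨derivWithin h (Ioi d) d, fun t ht => ?_⟩
  rcases lt_trichotomy t d with htd | rfl | htd
  · have h1 := (hh.slope_le_leftDeriv_of_mem_interior ht hd htd).trans
      (hh.leftDeriv_le_rightDeriv_of_mem_interior hd)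
    rw [slope_def_field, div_le_iff₀ (by linarith)] at h1
    linarith
  · simp
  · have h1 := hh.rightDeriv_le_slope_of_mem_interior hd ht htd
    rw [slope_def_field, le_div_iff₀ (by linarith)] at h1
    linarith

variable {n : ℕ}

theorem det_toEuclideanCLM (M : Matrix (Fin n) (Fin n) ℝ) :
    (toEuclideanCLM (n := Fin n) (𝕜 := ℝ) M).det = M.det := by
  rw [ContinuousLinearMap.det, coe_toEuclideanCLM_eq_toEuclideanLin,
    toEuclideanLin_eq_toLin_orthonormal, LinearMap.det_toLin]

theorem mem_matPos {A : Matrix (Fin n) (Fin n) ℝ} : A ∈ MatPos n ↔ 0 < A.det := Iff.rfl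

theorem det_toEuclideanCLM_symm (A : E n →L[ℝ] E n) :
    ((toEuclideanCLM (n := Fin n) (𝕜 := ℝ)).symm A).det = A.det := by
  rw [← det_toEuclideanCLM, StarAlgEquiv.apply_symm_apply]

theorem grad_eq (y : E n → E n) (x : E n) :
    grad y x = (toEuclideanCLM (n := Fin n) (𝕜 := ℝ)).symm (fderiv ℝ y x) := by
  rw [eq_comm, StarAlgEquiv.symm_apply_eq]
  refine ContinuousLinearMap.coe_injective ((EuclideanSpace.basisFun (Fin n) ℝ).toBasis.ext fun j => ?_)
  ext i
  simp [grad]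

theorem continuous_toEuclideanCLM_symm :
    Continuous (toEuclideanCLM (n := Fin n) (𝕜 := ℝ)).symm :=
  LinearMap.continuous_of_finiteDimensional
    ((toEuclideanCLM (n := Fin n) (𝕜 := ℝ)).symm.toAlgEquiv.toLinearMap)

theorem matImage_eq (M : Matrix (Fin n) (Fin n) ℝ) (Ω : Set (E n)) :
    matImage M Ω = toEuclideanCLM (n := Fin n) (𝕜 := ℝ) M '' Ω := rfl

theorem extAverage_of_integrableOn {Ω : Set (E n)} {f : E n → ℝ} (hf : IntegrableOn f Ω) :
    extAverage Ω f = ((⨍ x in Ω, f x : ℝ) : EReal) := by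
  have h1 := Integrable.to_average hf
  have h2 := integral_eq_lintegral_pos_part_sub_lintegral_neg_part h1
  have h3 : ∫⁻ x, ENNReal.ofReal (f x) ∂((volume.restrict Ω univ)⁻¹ • volume.restrict Ω) ≠ ⊤ :=
    h1.lintegral_lt_top.ne
  have h4 : ∫⁻ x, ENNReal.ofReal (-f x) ∂((volume.restrict Ω univ)⁻¹ • volume.restrict Ω) ≠ ⊤ :=
    h1.neg.lintegral_lt_top.ne
  rw [extAverage, average, h2, EReal.coe_sub, EReal.coe_ennreal_toReal h3,
    EReal.coe_ennreal_toReal h4]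
  rfl

theorem extAverage_mono {Ω : Set (E n)} (hΩ : MeasurableSet Ω) {f g : E n → ℝ}
    (h : ∀ x ∈ Ω, f x ≤ g x) : extAverage Ω f ≤ extAverage Ω g := by
  refine EReal.sub_le_sub ?_ ?_
  · refine EReal.coe_ennreal_le_coe_ennreal_iff.2 ?_
    refine lintegral_mono_ae (Measure.ae_smul_measure ?_ _)
    filter_upwards [ae_restrict_mem hΩ] with x hx
    exact ENNReal.ofReal_le_ofReal (h x hx)
  · refine EReal.coe_ennreal_le_coe_ennreal_iff.2 ?_
    refine lintegral_mono_ae (Measure.ae_smul_measure ?_ _)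
    filter_upwards [ae_restrict_mem hΩ] with x hx
    exact ENNReal.ofReal_le_ofReal (neg_le_neg (h x hx))

/-- Jensen's inequality for convex functions of the Jacobian determinant. -/
theorem le_extAverage_of_convexOn {Ω : Set (E n)} (hΩ : IsOpen Ω) (hne : Ω.Nonempty)
    (hb : Bornology.IsBounded Ω) {h : ℝ → ℝ} (hh : ConvexOn ℝ (Ioi 0) h)
    {M : Matrix (Fin n) (Fin n) ℝ} (hM : M ∈ MatPos n) {y : E n → E n} (hy : y ∈ admissible Ω M) :
    ((h M.det : ℝ) : EReal) ≤ extAverage Ω fun x => h (grad y x).det := by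
  obtain ⟨hy1, hmaps, ⟨g, -, hg, hgl, hgr⟩, hpos⟩ := hy
  obtain ⟨c, hc⟩ := hh.exists_subgradient (d := M.det) (by rw [interior_Ioi]; exact hM)
  have himg : y '' Ω = toEuclideanCLM (n := Fin n) (𝕜 := ℝ) M '' Ω := by
    rw [← matImage_eq]
    exact (hmaps.image_subset).antisymm fun z hz => ⟨g z, hg hz, hgr hz⟩
  have hder : ∀ x ∈ Ω, HasFDerivWithinAt y (fderiv ℝ y x) Ω x := fun x hx =>
    ((hy1.contDiffAt (hΩ.mem_nhds hx)).differentiableAt one_ne_zero).hasFDerivAt.hasFDerivWithinAt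
  have hdet : ∀ x, (grad y x).det = (fderiv ℝ y x).det := fun x => by
    rw [grad_eq, det_toEuclideanCLM_symm]
  have hdetM : |LinearMap.det (toEuclideanCLM (n := Fin n) (𝕜 := ℝ) M : E n →ₗ[ℝ] E n)| = M.det :=
    (congrArg abs (det_toEuclideanCLM M)).trans (abs_of_pos hM)
  have habs : EqOn (fun x => |(fderiv ℝ y x).det| • (1 : ℝ)) (fun x => (grad y x).det) Ω := by
    intro x hx
    simp only [← hdet, smul_eq_mul, mul_one]
    exact abs_of_pos (hpos x hx)
  have hvol : volume.real (y '' Ω) = M.det * volume.real Ω := by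
    rw [himg, measureReal_def, Measure.addHaar_image_continuousLinearMap, hdetM,
      ENNReal.toReal_mul, ENNReal.toReal_ofReal (mem_matPos.1 hM).le]
    rfl
  have hfin : volume (y '' Ω) ≠ ⊤ := by
    rw [himg, Measure.addHaar_image_continuousLinearMap]
    exact ENNReal.mul_ne_top ENNReal.ofReal_ne_top hb.measure_lt_top.ne
  have hint : IntegrableOn (fun x => (grad y x).det) Ω := by
    rw [← integrableOn_congr_fun habs hΩ.measurableSet,
      ← integrableOn_image_iff_integrableOn_abs_det_fderiv_smul volume hΩ.measurableSet hder
        hgl.injOn (fun _ => (1 : ℝ))]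
    exact integrableOn_const hfin
  have hval : ∫ x in Ω, (grad y x).det = M.det * volume.real Ω := by
    rw [← setIntegral_congr_fun hΩ.measurableSet habs,
      ← integral_image_eq_integral_abs_det_fderiv_smul volume hΩ.measurableSet hder hgl.injOn
        (fun _ => (1 : ℝ)),
      ← hvol]
    simp
  have hΩ0 : volume.real Ω ≠ 0 :=
    (ENNReal.toReal_pos (hΩ.measure_pos volume hne).ne' hb.measure_lt_top.ne).ne'
  have hconst : ∀ a : ℝ, IntegrableOn (fun _ : E n => a) Ω := fun a =>
    integrableOn_const hb.measure_lt_top.ne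
  have hsub : IntegrableOn (fun x => c * ((grad y x).det - M.det)) Ω :=
    (hint.sub (hconst _)).const_mul c
  refine le_trans (le_of_eq ?_) (extAverage_mono hΩ.measurableSet
    (f := fun x => h M.det + c * ((grad y x).det - M.det)) fun x hx => hc _ (hpos x hx))
  rw [extAverage_of_integrableOn (f := fun x => h M.det + c * ((grad y x).det - M.det))
    ((hconst _).add hsub)]
  congr 1
  rw [setAverage_eq, integral_add (hconst _) hsub, integral_const_mul,
    integral_sub hint (hconst _), hval]
  simp
  field_simp
  ring

/-- The competitor is `A ∘ φ`. As `φ` is `C¹` on the whole space and `Ω` is bounded, the energy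
density is integrable and the extended average is an ordinary one. -/
theorem isStable_of_le_extAverage {Ω : Set (E n)} (hΩ : IsOpen Ω) (hne : Ω.Nonempty)
    (hb : Bornology.IsBounded Ω) {Ψ : Matrix (Fin n) (Fin n) ℝ → ℝ} (hΨ : ContinuousOn Ψ (MatPos n))
    (h : ∀ M ∈ MatPos n, ∀ y ∈ admissible Ω M,
      ((Ψ M : ℝ) : EReal) ≤ extAverage Ω fun x => Ψ (grad y x)) :
    IsStable Ω fun A => Ψ ((toEuclideanCLM (n := Fin n) (𝕜 := ℝ)).symm A) := by
  intro A hA φ hφ1 hφ2 hmem hdet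
  set M := (toEuclideanCLM (n := Fin n) (𝕜 := ℝ)).symm A with hMdef
  have hAM : toEuclideanCLM (n := Fin n) (𝕜 := ℝ) M = A := StarAlgEquiv.apply_symm_apply _ _
  have hM : M ∈ MatPos n := by
    rwa [mem_matPos, hMdef, det_toEuclideanCLM_symm]
  have hgrad : ∀ x, grad (fun x => A (φ x)) x =
      (toEuclideanCLM (n := Fin n) (𝕜 := ℝ)).symm (A * fderiv ℝ φ x) := by
    intro x
    rw [grad_eq]
    congr 1
    exact (A.hasFDerivAt.comp x (hφ1.differentiable one_ne_zero x).hasFDerivAt).fderiv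
  have hpos : ∀ x, (toEuclideanCLM (n := Fin n) (𝕜 := ℝ)).symm (A * fderiv ℝ φ x) ∈ MatPos n := by
    intro x
    rw [mem_matPos, det_toEuclideanCLM_symm, clm_det_mul]
    exact mul_pos hA (hdet x)
  have hMu : IsUnit M.det := isUnit_iff_ne_zero.2 (ne_of_gt hM)
  have hinv : ∀ z, toEuclideanCLM (n := Fin n) (𝕜 := ℝ) M⁻¹ (A z) = z := by
    intro z
    rw [← hAM, ← mul_apply_eq_comp, ← map_mul, nonsing_inv_mul M hMu, map_one]
    rfl
  have hadm : (fun x => A (φ x)) ∈ admissible Ω M := by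
    refine ⟨(A.contDiff.comp hφ1).contDiffOn, fun x hx => ?_,
      ⟨fun z => φ.symm (toEuclideanCLM (n := Fin n) (𝕜 := ℝ) M⁻¹ z),
      (hφ2.comp (ContinuousLinearMap.contDiff _)).contDiffOn, ?_, ?_⟩, ?_⟩
    · rw [matImage_eq, hAM]
      exact ⟨φ x, (hmem x).2 hx, rfl⟩
    · rw [matImage_eq, hAM]
      rintro _ ⟨x, hx, rfl⟩
      simp only [hinv]
      rw [← hmem]
      simpa using hx
    · rw [matImage_eq, hAM]
      constructor
      · intro x _
        simp [hinv]
      · rintro _ ⟨x, _, rfl⟩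
        simp [hinv]
    · intro x _
      rw [hgrad]
      exact hpos x
  have hcont : Continuous fun x =>
      Ψ ((toEuclideanCLM (n := Fin n) (𝕜 := ℝ)).symm (A * fderiv ℝ φ x)) :=
    hΨ.comp_continuous (continuous_toEuclideanCLM_symm.comp
      (continuous_const.mul (hφ1.continuous_fderiv one_ne_zero))) hpos
  have h1 := h M hM _ hadm
  simp only [hgrad] at h1
  rw [extAverage_of_integrableOn (integrableOn_of_continuous hb hcont), EReal.coe_le_coe_iff,
    setAverage_eq, smul_eq_mul] at h1
  have hΩ0 : 0 < volume.real Ω :=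
    ENNReal.toReal_pos (hΩ.measure_pos volume hne).ne' hb.measure_lt_top.ne
  rw [inv_mul_eq_div, le_div_iff₀ hΩ0] at h1
  rw [integral_sub (integrableOn_of_continuous hb hcont)
    (integrableOn_of_continuous hb continuous_const)]
  simp only [setIntegral_const, smul_eq_mul]
  linarith

/-- Pull `f` back by the projection onto `e^⊥` to get a function `k` constant along `e`. The
unnormalized normal `w` then represents `⟪e, ·⟫ - fderiv ℝ k x`, and the factor `‖w‖⁻¹` can be moved
onto the shear vector. -/
theorem IsStable.apply_mul_shear_of_outwardNormal {Ω : Set (E n)} (hΩ : IsOpen Ω)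
    {Φ : (E n →L[ℝ] E n) → ℝ} (hst : IsStable Ω Φ) (hΦ : ContinuousOn Φ {A | 0 < A.det})
    {x ν : E n} (hν : IsC1OutwardNormal Ω x ν) {v : E n} (hv : ⟪ν, v⟫_ℝ = 0)
    {B : E n →L[ℝ] E n} (hB : 0 < B.det) :
    Φ (B * (1 + (innerSL ℝ ν).smulRight v)) = Φ B := by
  obtain ⟨hx, e, f, ⟨he, hf, ε, hε, hsub, hfr⟩, w, hw, rfl⟩ := hν
  let K : Submodule ℝ (E n) := (Submodule.span ℝ {e})ᗮ
  let k : E n → ℝ := fun z => f (K.orthogonalProjectionOnto z)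
  have hPe : K.orthogonalProjectionOnto e = 0 := by
    rw [Submodule.orthogonalProjectionOnto_eq_zero_iff]
    exact Submodule.le_orthogonal_orthogonal _ (Submodule.mem_span_singleton_self e)
  have hk : ∀ (z : E n) (t : ℝ), k (z + t • e) = k z := by
    intro z t
    simp only [k, map_add, map_smul, hPe, smul_zero, add_zero]
  have hk1 : ContDiff ℝ 1 k := hf.comp K.orthogonalProjectionOnto.contDiff
  have hxball : x ∈ Metric.ball x ε := Metric.mem_ball_self hε
  have hxk : ⟪e, x⟫_ℝ = k x := (hfr.subset ⟨hx, hxball⟩).2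
  have hmem : ∀ z ∈ Metric.ball x ε, z ∈ Ω ↔ ⟪e, z⟫_ℝ < k z := by
    intro z hz
    constructor
    · exact fun hzΩ => (hsub.subset ⟨hzΩ, hz⟩).2
    · exact fun hzk => (hsub.superset ⟨hz, hzk⟩).1
  have hm : innerSL ℝ e - fderiv ℝ k x = innerSL ℝ w := by
    ext u
    have h1 : fderiv ℝ k x u =
        fderiv ℝ f (K.orthogonalProjectionOnto x) (K.orthogonalProjectionOnto u) := by
      have := ((hf.differentiable one_ne_zero (K.orthogonalProjectionOnto x)).hasFDerivAt.comp x
        K.orthogonalProjectionOnto.hasFDerivAt).fderiv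
      exact DFunLike.congr_fun this u
    rw [_root_.sub_apply, h1, innerSL_apply_apply, innerSL_apply_apply, hw, inner_sub_left,
      ← inner_gradient_left]
    congr 1
    exact (Submodule.inner_orthogonalProjectionOnto_eq_of_mem_left _ _)
  have h1 : (innerSL ℝ (‖w‖⁻¹ • w)).smulRight v =
      (innerSL ℝ e - fderiv ℝ k x).smulRight (‖w‖⁻¹ • v) := by
    rw [hm]
    ext u
    simp [smul_smul, mul_comm]
  rw [h1]
  refine hst.apply_mul_shear hΩ hΦ he hk1 hk hxk hε hmem ?_ hB
  rw [hm, map_smul, innerSL_apply_apply]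
  rw [real_inner_smul_left] at hv
  exact hv

end BoundarySliding

end

/-! ### Assembly: dependence on the determinant and the final equivalence. -/

noncomputable section

namespace BoundarySliding

open Filter Topology Matrix

theorem toEuclideanCLM_vecMulVec {n : ℕ} (v : Fin n → ℝ) (ν : E n) :
    toEuclideanCLM (n := Fin n) (𝕜 := ℝ) (vecMulVec v (WithLp.ofLp ν)) =
      (innerSL ℝ ν).smulRight (WithLp.toLp 2 v) := by
  ext u i
  rw [ofLp_toEuclideanCLM, vecMulVec_mulVec]
  simp [PiLp.inner_apply, dotProduct, mul_comm]

/-- The existence of spanning normals makes a stable density a function of the determinant. -/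
theorem eq_of_det_eq_of_isStable {n : ℕ} (hn : 1 ≤ n) {Ω : Set (E n)} (hΩ : IsOpen Ω)
    (hbdry : 1 < n → ∃ x ν : Fin n → E n,
      (∀ i, IsC1OutwardNormal Ω (x i) (ν i)) ∧ Submodule.span ℝ (range ν) = ⊤)
    {Ψ : Matrix (Fin n) (Fin n) ℝ → ℝ} (hΨ : ContinuousOn Ψ (MatPos n))
    (hst : IsStable Ω fun A => Ψ ((toEuclideanCLM (n := Fin n) (𝕜 := ℝ)).symm A))
    {A A' : Matrix (Fin n) (Fin n) ℝ} (hA : A ∈ MatPos n) (hdet : A.det = A'.det) :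
    Ψ A' = Ψ A := by
  rcases hn.eq_or_lt with rfl | hn
  · have : A = A' := by
      ext i j
      rw [det_fin_one, det_fin_one] at hdet
      rwa [Subsingleton.elim i 0, Subsingleton.elim j 0]
    rw [this]
  obtain ⟨x, ν, hν, hspan⟩ := hbdry hn
  refine eq_of_det_eq_of_shear_invariant hn hspan (fun i M hM v hv => ?_) hA hdet
  have hΦ : ContinuousOn (fun A => Ψ ((toEuclideanCLM (n := Fin n) (𝕜 := ℝ)).symm A))
      {A | 0 < A.det} :=
    hΨ.comp continuous_toEuclideanCLM_symm.continuousOn fun A hA => by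
      rw [mem_matPos, det_toEuclideanCLM_symm]; exact hA
  have hv' : ⟪ν i, WithLp.toLp 2 v⟫_ℝ = 0 := by
    rw [← hv]
    simp [PiLp.inner_apply, dotProduct]
  have := hst.apply_mul_shear_of_outwardNormal hΩ hΦ (hν i) hv'
    (B := toEuclideanCLM (n := Fin n) (𝕜 := ℝ) M) (by rw [det_toEuclideanCLM]; exact hM)
  rw [← toEuclideanCLM_vecMulVec, ← map_one (toEuclideanCLM (n := Fin n) (𝕜 := ℝ)), ← map_add,
    ← map_mul] at this
  simpa only [StarAlgEquiv.symm_apply_apply] using this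

/-- A continuous density for which linear maps are minimizers is a convex function of the
determinant. -/
theorem exists_convexOn_of_isStable {n : ℕ} (hn : 1 ≤ n) {Ω : Set (E n)} (hΩ : IsOpen Ω)
    (hne : Ω.Nonempty) (hb : Bornology.IsBounded Ω)
    (hbdry : 1 < n → ∃ x ν : Fin n → E n,
      (∀ i, IsC1OutwardNormal Ω (x i) (ν i)) ∧ Submodule.span ℝ (range ν) = ⊤)
    {Ψ : Matrix (Fin n) (Fin n) ℝ → ℝ} (hΨ : ContinuousOn Ψ (MatPos n))
    (hst : IsStable Ω fun A => Ψ ((toEuclideanCLM (n := Fin n) (𝕜 := ℝ)).symm A)) :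
    ∃ h : ℝ → ℝ, ConvexOn ℝ (Ioi 0) h ∧ ∀ A ∈ MatPos n, Ψ A = h A.det := by
  set i₀ : Fin n := ⟨0, hn⟩
  set D : ℝ → Matrix (Fin n) (Fin n) ℝ := fun t => Matrix.diagonal (Function.update 1 i₀ t) with hD
  have hDdet : ∀ t, (D t).det = t := fun t => by
    rw [hD, Matrix.det_diagonal, Finset.prod_update_of_mem (Finset.mem_univ _)]
    simp
  have hDc : Continuous D := (continuous_const.update i₀ continuous_id).matrix_diagonal
  have hval : ∀ A ∈ MatPos n, Ψ A = Ψ (D A.det) := fun A hA =>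
    (eq_of_det_eq_of_isStable hn hΩ hbdry hΨ hst hA (hDdet _).symm).symm
  refine ⟨fun t => Ψ (D t), ?_, hval⟩
  refine hst.convexOn hΩ hne hb (h := fun t => Ψ (D t))
    (hΨ.comp hDc.continuousOn fun t ht => ?_) (fun A hA => ?_)
    (e := EuclideanSpace.single i₀ 1) (by simp)
  · rw [mem_matPos, hDdet]
    exact ht
  · have := hval ((toEuclideanCLM (n := Fin n) (𝕜 := ℝ)).symm A)
      (by rw [mem_matPos, det_toEuclideanCLM_symm]; exact hA)
    rwa [det_toEuclideanCLM_symm] at this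

end BoundarySliding

end

theorem theorem4p2 (n : ℕ) (hn : 1 ≤ n)
    (Ω : Set (BoundarySliding.E n)) (hopen : IsOpen Ω) (hconn : IsConnected Ω)
    (hbdd : Bornology.IsBounded Ω)
    (hbdry : 1 < n → ∃ x ν : Fin n → BoundarySliding.E n,
      (∀ i, BoundarySliding.IsC1OutwardNormal Ω (x i) (ν i)) ∧
      Submodule.span ℝ (Set.range ν) = ⊤)
    (Ψ : Matrix (Fin n) (Fin n) ℝ → ℝ) (hΨ : ContinuousOn Ψ (BoundarySliding.MatPos n)) :
    (∀ M ∈ BoundarySliding.MatPos n, ∀ y ∈ BoundarySliding.admissible Ω M,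
      ((Ψ M : ℝ) : EReal) ≤
        BoundarySliding.extAverage Ω (fun x => Ψ (BoundarySliding.grad y x))) ↔
    ∃ h : ℝ → ℝ, ConvexOn ℝ (Set.Ioi 0) h ∧
      ∀ A ∈ BoundarySliding.MatPos n, Ψ A = h A.det := by
  constructor
  · intro H
    exact BoundarySliding.exists_convexOn_of_isStable hn hopen hconn.nonempty hbdd hbdry hΨ
      (BoundarySliding.isStable_of_le_extAverage hopen hconn.nonempty hbdd hΨ H)
  · rintro ⟨h, hh, hΨh⟩ M hM y hy
    rw [hΨh M hM]
    exact (BoundarySliding.le_extAverage_of_convexOn hopen hconn.nonempty hbdd hh hM hy).trans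
      (BoundarySliding.extAverage_mono hopen.measurableSet
        fun x hx => (hΨh _ (hy.det_pos x hx)).ge)
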